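/- There is an absolute constant $c_1'>0$ such that the following holds. Let $m_1,m_2,n\ge 1$ be integers, $d=m_1+m_2$, $A_0\in\mathbb R^{m_1\times m_2}$, $\sigma\ge 0$, and observe $(X_i,Y_i)$, $i=1,\dots,n$, with $$Y_i=\mathrm{tr}(X_i^TA_0)+\sigma\xi_i ,$$ where the $\xi_i$ are independent real random variables with $\mathbb E\,\xi_i=0$ and $\mathbb E\,\xi_i^2=1$, and the $X_i$ are i.i.d. random matrices with a distribution $\Pi$ on the set $\{e_je_k^T: 1\le j\le m_1,\,1\le k\le m_2\}$ ($e_j$, $e_k$ the canonical basis vectors of $\mathbb R^{m_1}$, $\mathbb R^{m_2}$). Put $\pi_{jk}=\Pi(\{e_je_k^T\})$ and assume that, for some constants $L\ge1$ and $\mu\ge1$, $$\max_{j,k}\Bigl(\sum_{j'}\pi_{j'k},\ \sum_{k'}\pi_{jk'}\Bigr)\le \frac{L}{\min(m_1,m_2)},\qquad \pi_{jk}\ge\frac1{\mu m_1m_2}\ \text{ for all } j,k .$$ For a matrix $A$ let $\|A\|_\infty=\max_{j,k}|a_{jk}|$, let $\|A\|$ be the largest singular value, $\|A\|_1$ the sum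 of the singular values (nuclear norm) and $\|A\|_2$ the Frobenius norm, and let $\langle A,B\rangle=\mathrm{tr}(A^TB)$. Let $$Q(A)=\sqrt{\tfrac1n\sum_{i=1}^n\bigl(Y_i-\langle X_i,A\rangle\bigr)^2},\qquad \Sigma=\frac{\sigma}{n}\sum_{i=1}^n\xi_iX_i,\qquad \Sigma_R=\frac1n\sum_{i=1}^n\varepsilon_iX_i ,$$ where $(\varepsilon_i)$ are i.i.d. Rademacher variables independent of $(X_i)$; in particular $Q(A_0)=\sigma\sqrt{\frac1n\sum_i\xi_i^2}$. Let $\|A_0\|_\infty\le \mathbf a$ for a constant $\mathbf a$, and let $\lambda>0$ satisfy $\lambda\le\sqrt\rho$, where $\rho=\frac1{16\mu m_1m_2\,\mathrm{rank}(A_0)}$ ($\rho=+\infty$ if $A_0=0$). Let $$\hat A_{\mathrm{SQ}}\in\mathop{\mathrm{arg\,min}}_{\|A\|_\infty\le\mathbf a}\bigl\{Q(A)+\lambda\|A\|_1\bigr\}$$ be any minimizer. Then there is an event of probability at least $1-\frac2d$ on which, whenever $\lambda\,Q(A_0)\ge 3\|\Sigma\|$ (that is, $\lambda\ge 3\|\Sigma\|/Q(A_0)$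 if $Q(A_0)>0$; if $Q(A_0)=0$, then $\Sigma=0$ and this holds), $$\frac{\|\hat A_{\mathrm{SQ}}-A_0\|_2^2}{m_1m_2}\le c_1'\max\Bigl\{\mu^2m_1m_2\,\mathrm{rank}(A_0)\bigl(Q^2(A_0)\lambda^2+\mathbf a^2(\mathbb E\|\Sigma_R\|)^2\bigr),\ \mathbf a^2\mu\sqrt{\frac{\log d}{n}}\Bigr\}.$$ -/

import Mathlib

open MeasureTheory ProbabilityTheory

namespace MatrixCompletion

noncomputable section

/-- Real matrices carry the product (Borel) σ-algebra. -/
instance instMeasurableSpaceMatrix {m₁ m₂ : ℕ} :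
    MeasurableSpace (Matrix (Fin m₁) (Fin m₂) ℝ) :=
  inferInstanceAs (MeasurableSpace (Fin m₁ → Fin m₂ → ℝ))

/-! ### Matrix norms -/

/-- The singular values of `A` in decreasing order, indexed from `0`
(those with index at least `min m₁ m₂` vanish). -/
def singularValue {m₁ m₂ : ℕ} (A : Matrix (Fin m₁) (Fin m₂) ℝ) (j : ℕ) : ℝ :=
  (Matrix.toEuclideanLin A).singularValues j

/-- The Schatten-`q` (quasi-)norm `‖A‖_q`; `q = 1` is the nuclear norm and `q = 2` the
Frobenius norm. -/
def schattenNorm {m₁ m₂ : ℕ} (q : ℝ) (A : Matrix (Fin m₁) (Fin m₂) ℝ) : ℝ :=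
  (∑ j ∈ Finset.range (min m₁ m₂), singularValue A j ^ q) ^ (1 / q)

/-- The spectral norm `‖A‖`, the largest singular value. -/
def specNorm {m₁ m₂ : ℕ} (A : Matrix (Fin m₁) (Fin m₂) ℝ) : ℝ :=
  singularValue A 0

/-- The entrywise maximum norm `‖A‖_∞ = max |a_ij|`. -/
def maxNorm {m₁ m₂ : ℕ} (A : Matrix (Fin m₁) (Fin m₂) ℝ) : ℝ :=
  ⨆ p : Fin m₁ × Fin m₂, |A p.1 p.2|

/-- The scalar product `⟨A, B⟩ = tr (Aᵀ B)`. -/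
def scalarProd {m₁ m₂ : ℕ} (A B : Matrix (Fin m₁) (Fin m₂) ℝ) : ℝ :=
  (A.transpose * B).trace

/-! ### Sampling distribution -/

/-- The set of the matrices `e_j e_kᵀ`. -/
def designSet (m₁ m₂ : ℕ) : Set (Matrix (Fin m₁) (Fin m₂) ℝ) :=
  {B | ∃ j k, B = Matrix.single j k 1}

/-- `π_jk`, the probability to observe the `(j, k)`-th entry under the sampling law. -/
def entryProb {m₁ m₂ : ℕ} (law : Measure (Matrix (Fin m₁) (Fin m₂) ℝ))
    (j : Fin m₁) (k : Fin m₂) : ℝ :=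
  law.real {Matrix.single j k 1}

/-- `C_k`, the probability to observe an element of the `k`-th column. -/
def colProb {m₁ m₂ : ℕ} (law : Measure (Matrix (Fin m₁) (Fin m₂) ℝ)) (k : Fin m₂) : ℝ :=
  ∑ j, entryProb law j k

/-- `R_j`, the probability to observe an element of the `j`-th row. -/
def rowProb {m₁ m₂ : ℕ} (law : Measure (Matrix (Fin m₁) (Fin m₂) ℝ)) (j : Fin m₁) : ℝ :=
  ∑ k, entryProb law j k

/-! ### Loss and estimator -/

/-- `Q(A) = √(n⁻¹ ∑ (y_i - ⟨x_i, A⟩)²)` for the data `(x_i, y_i)`. -/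
def rootLoss {m₁ m₂ n : ℕ} (x : Fin n → Matrix (Fin m₁) (Fin m₂) ℝ) (y : Fin n → ℝ)
    (A : Matrix (Fin m₁) (Fin m₂) ℝ) : ℝ :=
  √((1 / (n : ℝ)) * ∑ i, (y i - scalarProd (x i) A) ^ 2)

/-- `B` is a square-root estimator: it minimises `Q(A) + lam * ‖A‖₁` over `‖A‖_∞ ≤ a`. -/
def IsSqrtEstimator {m₁ m₂ n : ℕ} (a lam : ℝ) (x : Fin n → Matrix (Fin m₁) (Fin m₂) ℝ)
    (y : Fin n → ℝ) (B : Matrix (Fin m₁) (Fin m₂) ℝ) : Prop :=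
  maxNorm B ≤ a ∧
    ∀ A, maxNorm A ≤ a →
      rootLoss x y B + lam * schattenNorm 1 B ≤ rootLoss x y A + lam * schattenNorm 1 A

/-! ### Stochastic terms -/

/-- `n⁻¹ ∑ w_i x_i`. -/
def weightedMean {m₁ m₂ n : ℕ} (w : Fin n → ℝ) (x : Fin n → Matrix (Fin m₁) (Fin m₂) ℝ) :
    Matrix (Fin m₁) (Fin m₂) ℝ :=
  (1 / (n : ℝ)) • ∑ i, w i • x i

/-- The Rademacher law on `ℝ`: the values `1` and `-1` with probability one half each. -/
def rademacher : Measure ℝ :=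
  (2⁻¹ : ENNReal) • Measure.dirac 1 + (2⁻¹ : ENNReal) • Measure.dirac (-1)

/-- `𝔼 ‖Σ_R‖` with `Σ_R = n⁻¹ ∑ ε_i X_i`: the `ε_i` are the coordinates of the second factor,
hence i.i.d. Rademacher and independent of the `X_i`. -/
def expNormSigmaR {Ω : Type*} [MeasurableSpace Ω] {m₁ m₂ n : ℕ} (P : Measure Ω)
    (X : Fin n → Ω → Matrix (Fin m₁) (Fin m₂) ℝ) : ℝ :=
  ∫ z : Ω × (Fin n → ℝ), specNorm (weightedMean z.2 fun i => X i z.1)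
    ∂(P.prod (Measure.pi fun _ : Fin n => rademacher))

end

end MatrixCompletion

open MatrixCompletion

/-!
The argument separates a deterministic part, about one realisation of the data, from a
probabilistic part, about the design only; the noise enters through `3 ‖Σ‖ ≤ λ Q(A₀)` alone.

*Deterministic part.* Let `D` be the error of the estimator. Relative to the row and column spaces
of `A₀`, the error splits into a part of rank at most `2 rank A₀`, of nuclear norm `u`, and a part
whose nuclear norm `v` adds to that of `A₀` (`exists_nuclearNorm_decomposition`; everything about
the nuclear norm comes from its duality with the operator norm). Minimality gives
`Q(B) - Q(A₀) ≤ λ (u - v)`, convexity of `Q` gives `Q(B) - Q(A₀) ≥ -λ (u + v) / 3`, whence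
`v ≤ 2 u`: the error is nearly of low rank, with `‖D‖₁ ≤ 3 u` and `u² ≤ 2 rank(A₀) ‖D‖₂²`. Expanding `Q(B)²`
then bounds the empirical second moment `n⁻¹ ∑ ⟨X_i, D⟩²` by `4 λ Q(A₀) u + λ² u²`
(`sqrtEstimator_basic_inequality`).

*Probabilistic part.* The empirical second moment has to be bounded below by half the squared `L²`
norm of `D` under the sampling law, for all nearly low-rank `D` at once, as soon as that norm
exceeds a threshold `θ` (`restricted_strong_convexity`). Since both sides are quadratic in `D` and the
constraints survive shrinking, only `D` with `L²` norm exactly `θ` matter.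
On that level the expected supremum of the empirical process is at most a multiple of `𝔼 ‖Σ_R‖`, by
symmetrization and contraction (`sampleMean_iSup_sq_le`) together with duality, and McDiarmid's
inequality (`sampleMean_tail_le`) controls its deviation. As the design takes finitely many values,
all of this is about finite weighted sums; `measureReal_iUnion_designAtom` and
`expNormSigmaR_eq_sampleMean` translate to the given probability space.

Either the `L²` norm of `D / (2a)` is below `θ`, which is already the second term and the `𝔼 ‖Σ_R‖`
part of the bound, or strong convexity applies, and the bound on `λ` allows the quadratic term
`λ² u²` to be absorbed (`frobenius_bound_of_basic_inequality`).
-/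

/-! ### Singular values and the nuclear norm -/

section Operators

open Module

variable {E F : Type*} [NormedAddCommGroup E] [InnerProductSpace ℝ E]
  [NormedAddCommGroup F] [InnerProductSpace ℝ F]

/-- Parseval's identity for a map that sends an orthonormal basis to pairwise orthogonal
vectors. -/
theorem norm_sq_map_eq_sum {ι : Type*} [Fintype ι] [DecidableEq ι] (T : E →ₗ[ℝ] F)
    (v : OrthonormalBasis ι ℝ E) (s : ι → ℝ)
    (hv : ∀ i j, inner ℝ (T (v i)) (T (v j)) = if i = j then s i else 0) (x : E) :
    ‖T x‖ ^ 2 = ∑ i, inner ℝ (v i) x ^ 2 * s i := by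
  have hx : T x = ∑ i, inner ℝ (v i) x • T (v i) := by
    conv_lhs => rw [← v.sum_repr' x]
    simp
  rw [← real_inner_self_eq_norm_sq, hx, sum_inner]
  refine Finset.sum_congr rfl fun i _ => ?_
  simp only [inner_sum, inner_smul_left, inner_smul_right, hv]
  simp
  ring

theorem sum_sq_inner_eq_norm_sq {ι : Type*} [Fintype ι] (v : OrthonormalBasis ι ℝ E) (x : E) :
    ∑ i, inner ℝ (v i) x ^ 2 = ‖x‖ ^ 2 := by
  simpa using v.sum_sq_norm_inner_right x

variable [FiniteDimensional ℝ E] [FiniteDimensional ℝ F]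

/-- The Hilbert–Schmidt inner product `tr (S* T)` of two linear maps. -/
noncomputable def hsInner (S T : E →ₗ[ℝ] F) : ℝ :=
  LinearMap.trace ℝ E (LinearMap.adjoint S ∘ₗ T)

/-- The nuclear norm of a linear map: the sum of its singular values. Those whose index is at
least `dim E` vanish, so that a finite sum suffices. -/
noncomputable def nuclearNorm (T : E →ₗ[ℝ] F) : ℝ :=
  ∑ i : Fin (finrank ℝ E), T.singularValues i

theorem hsInner_eq_sum {ι : Type*} [Fintype ι] (S T : E →ₗ[ℝ] F) (b : OrthonormalBasis ι ℝ E) :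
    hsInner S T = ∑ i, inner ℝ (S (b i)) (T (b i)) := by
  rw [hsInner, LinearMap.trace_eq_sum_inner _ b]
  exact Finset.sum_congr rfl fun i _ => by
    rw [LinearMap.comp_apply, LinearMap.adjoint_inner_right]

theorem hsInner_add_left (S S' T : E →ₗ[ℝ] F) :
    hsInner (S + S') T = hsInner S T + hsInner S' T := by
  simp [hsInner, LinearMap.add_comp]

theorem hsInner_add_right (S T T' : E →ₗ[ℝ] F) :
    hsInner S (T + T') = hsInner S T + hsInner S T' := by
  simp [hsInner, LinearMap.comp_add]

theorem hsInner_neg_left (S T : E →ₗ[ℝ] F) : hsInner (-S) T = -hsInner S T := by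
  simp [hsInner, LinearMap.neg_comp]

theorem hsInner_self_nonneg (T : E →ₗ[ℝ] F) : 0 ≤ hsInner T T := by
  rw [hsInner_eq_sum _ _ (stdOrthonormalBasis ℝ E)]
  exact Finset.sum_nonneg fun i _ => real_inner_self_nonneg

theorem hsInner_comm (S T : E →ₗ[ℝ] F) : hsInner S T = hsInner T S := by
  simp only [hsInner_eq_sum _ _ (stdOrthonormalBasis ℝ E)]
  exact Finset.sum_congr rfl fun i _ => real_inner_comm _ _

theorem hsInner_comp_comp {p : F →ₗ[ℝ] F} {q : E →ₗ[ℝ] E} (hp : LinearMap.adjoint p = p)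
    (hq : LinearMap.adjoint q = q) (S T : E →ₗ[ℝ] F) :
    hsInner (p ∘ₗ S ∘ₗ q) T = hsInner S (p ∘ₗ T ∘ₗ q) := by
  rw [hsInner, hsInner, LinearMap.adjoint_comp, LinearMap.adjoint_comp, hp, hq]
  exact LinearMap.trace_comp_comm' q (LinearMap.adjoint S ∘ₗ p ∘ₗ T) |>.symm

/-- Maps with orthogonal ranges are orthogonal. -/
theorem hsInner_eq_zero_of_inner {S T : E →ₗ[ℝ] F} (h : ∀ x, inner ℝ (S x) (T x) = 0) :
    hsInner S T = 0 := by
  rw [hsInner_eq_sum _ _ (stdOrthonormalBasis ℝ E)]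
  exact Finset.sum_eq_zero fun i _ => h _

/-- Right singular vectors: an orthonormal basis that `T` maps to pairwise orthogonal vectors,
whose lengths are the singular values. -/
theorem exists_rightSingularBasis (T : E →ₗ[ℝ] F) :
    ∃ v : OrthonormalBasis (Fin (finrank ℝ E)) ℝ E,
      ∀ i j, inner ℝ (T (v i)) (T (v j)) = if i = j then T.singularValues i ^ 2 else 0 := by
  have hT := T.isSymmetric_adjoint_comp_self
  refine ⟨hT.eigenvectorBasis rfl, fun i j => ?_⟩
  rw [← LinearMap.adjoint_inner_right, ← LinearMap.comp_apply, hT.apply_eigenvectorBasis,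
    inner_smul_right, orthonormal_iff_ite.1 (hT.eigenvectorBasis rfl).orthonormal]
  split_ifs with h
  · subst h
    rw [T.sq_singularValues_fin rfl]
    simp
  · simp

theorem norm_map_rightSingular {T : E →ₗ[ℝ] F} {v : OrthonormalBasis (Fin (finrank ℝ E)) ℝ E}
    (hv : ∀ i j, inner ℝ (T (v i)) (T (v j)) = if i = j then T.singularValues i ^ 2 else 0)
    (i : Fin (finrank ℝ E)) : ‖T (v i)‖ = T.singularValues i := by
  have h := hv i i
  rw [if_pos rfl, real_inner_self_eq_norm_sq] at h
  exact (pow_left_inj₀ (norm_nonneg _) (T.singularValues_nonneg _) two_ne_zero).1 h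

theorem norm_map_le_singularValues_zero (T : E →ₗ[ℝ] F) (x : E) :
    ‖T x‖ ≤ T.singularValues 0 * ‖x‖ := by
  obtain ⟨v, hv⟩ := exists_rightSingularBasis T
  refine le_of_sq_le_sq ?_ (mul_nonneg (T.singularValues_nonneg _) (norm_nonneg _))
  rw [norm_sq_map_eq_sum T v _ hv, mul_pow, ← sum_sq_inner_eq_norm_sq v x, Finset.mul_sum]
  refine Finset.sum_le_sum fun i _ => ?_
  rw [mul_comm]
  refine mul_le_mul_of_nonneg_right ?_ (sq_nonneg _)
  exact pow_le_pow_left₀ (T.singularValues_nonneg _) (T.singularValues_antitone (Nat.zero_le _)) 2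

/-- Duality of the operator norm and the nuclear norm. -/
theorem hsInner_le_mul_nuclearNorm {S : E →ₗ[ℝ] F} {C : ℝ} (hS : ∀ x, ‖S x‖ ≤ C * ‖x‖)
    (T : E →ₗ[ℝ] F) : hsInner S T ≤ C * nuclearNorm T := by
  obtain ⟨v, hv⟩ := exists_rightSingularBasis T
  rw [hsInner_eq_sum _ _ v, nuclearNorm, Finset.mul_sum]
  refine Finset.sum_le_sum fun i _ => (real_inner_le_norm _ _).trans ?_
  rw [norm_map_rightSingular hv]
  refine mul_le_mul_of_nonneg_right ?_ (T.singularValues_nonneg _)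
  simpa using hS (v i)

/-- The bound of `hsInner_le_mul_nuclearNorm` is attained, by the partial isometry of the polar
decomposition. -/
theorem exists_hsInner_eq_nuclearNorm (T : E →ₗ[ℝ] F) :
    ∃ W : E →ₗ[ℝ] F, (∀ x, ‖W x‖ ≤ ‖x‖) ∧ hsInner W T = nuclearNorm T ∧
      (∀ x, W x ∈ LinearMap.range T) ∧ ∀ x, T x = 0 → W x = 0 := by
  obtain ⟨v, hv⟩ := exists_rightSingularBasis T
  -- where a singular value vanishes, its inverse is `0` by convention, and `W` vanishes as it
  -- should
  let W : E →ₗ[ℝ] F := v.toBasis.constr ℝ fun i => (T.singularValues i)⁻¹ • T (v i)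
  have hWv : ∀ i, W (v i) = (T.singularValues i)⁻¹ • T (v i) := fun i => by
    rw [← v.coe_toBasis]
    exact v.toBasis.constr_basis ℝ _ i
  have hW : ∀ i j, inner ℝ (W (v i)) (W (v j)) =
      if i = j then ((T.singularValues i)⁻¹ * T.singularValues i) ^ 2 else 0 := fun i j => by
    rw [hWv, hWv, inner_smul_left, inner_smul_right, hv]
    split_ifs with h
    · subst h
      simp
      ring
    · simp
  have hone : ∀ r : ℝ, (r⁻¹ * r) ^ 2 ≤ 1 := fun r => by
    rcases eq_or_ne r 0 with h | h <;> simp [h]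
  refine ⟨W, fun x => ?_, ?_, fun x => ?_, fun x hx => ?_⟩
  · refine le_of_sq_le_sq ?_ (norm_nonneg _)
    rw [norm_sq_map_eq_sum W v _ hW, ← sum_sq_inner_eq_norm_sq v x]
    exact Finset.sum_le_sum fun i _ => mul_le_of_le_one_right (sq_nonneg _) (hone _)
  · rw [hsInner_eq_sum _ _ v, nuclearNorm]
    refine Finset.sum_congr rfl fun i _ => ?_
    rw [hWv, inner_smul_left, hv, if_pos rfl]
    rcases eq_or_ne (T.singularValues i) 0 with h | h
    · simp [h]
    · simp
      field_simp
  · rw [← v.sum_repr' x, map_sum]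
    refine Submodule.sum_mem _ fun i _ => ?_
    rw [map_smul, hWv]
    exact Submodule.smul_mem _ _ (Submodule.smul_mem _ _ (LinearMap.mem_range_self T _))
  · have h0 := norm_sq_map_eq_sum T v _ hv x
    rw [hx, norm_zero, zero_pow two_ne_zero, eq_comm, Finset.sum_eq_zero_iff_of_nonneg
      fun i _ => mul_nonneg (sq_nonneg _) (sq_nonneg _)] at h0
    rw [← norm_eq_zero, ← sq_eq_zero_iff, norm_sq_map_eq_sum W v _ hW]
    refine Finset.sum_eq_zero fun i _ => ?_
    rcases mul_eq_zero.1 (h0 i (Finset.mem_univ _)) with h | h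
    · simp [h]
    · simp [pow_eq_zero_iff two_ne_zero |>.1 h]

theorem nuclearNorm_nonneg (T : E →ₗ[ℝ] F) : 0 ≤ nuclearNorm T :=
  Finset.sum_nonneg fun _ _ => T.singularValues_nonneg _

theorem hsInner_self_eq_sum_singularValues (T : E →ₗ[ℝ] F) :
    hsInner T T = ∑ i : Fin (finrank ℝ E), T.singularValues i ^ 2 := by
  obtain ⟨v, hv⟩ := exists_rightSingularBasis T
  rw [hsInner_eq_sum _ _ v]
  exact Finset.sum_congr rfl fun i _ => by rw [hv, if_pos rfl]

/-- Sums over the singular values only see those with index below the rank. -/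
theorem sum_singularValues_eq_sum_range (T : E →ₗ[ℝ] F) {g : ℝ → ℝ} (hg : g 0 = 0) {N : ℕ}
    (hN : finrank ℝ (LinearMap.range T) ≤ N) :
    ∑ i ∈ Finset.range N, g (T.singularValues i) =
      ∑ i ∈ Finset.range (finrank ℝ (LinearMap.range T)), g (T.singularValues i) := by
  refine (Finset.sum_subset (Finset.range_subset_range.2 hN) fun i _ hi => ?_).symm
  rw [T.singularValues_eq_zero_iff_le_finrank_range.2 (by simpa using hi), hg]

theorem nuclearNorm_sq_le_rank_mul (T : E →ₗ[ℝ] F) :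
    nuclearNorm T ^ 2 ≤ finrank ℝ (LinearMap.range T) * hsInner T T := by
  have hr : finrank ℝ (LinearMap.range T) ≤ finrank ℝ E := LinearMap.finrank_range_le T
  rw [hsInner_self_eq_sum_singularValues, nuclearNorm,
    Fin.sum_univ_eq_sum_range (fun i => T.singularValues i),
    Fin.sum_univ_eq_sum_range (fun i => T.singularValues i ^ 2),
    sum_singularValues_eq_sum_range T (g := fun x => x) rfl hr,
    sum_singularValues_eq_sum_range T (g := fun x => x ^ 2) (by simp) hr]
  simpa using sq_sum_le_card_mul_sum_sq
    (s := Finset.range (finrank ℝ (LinearMap.range T))) (f := fun i => T.singularValues i)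

/-- Decomposability of the nuclear norm at `T`: a perturbation `D` splits into a part `D₁` of
rank at most twice that of `T`, and a part `D₂` whose row and column spaces are orthogonal to
those of `T`, so that its nuclear norm adds to that of `T`. -/
theorem exists_nuclearNorm_decomposition (T D : E →ₗ[ℝ] F) :
    ∃ D₁ D₂ : E →ₗ[ℝ] F, D = D₁ + D₂ ∧
      nuclearNorm D₁ ^ 2 ≤ 2 * finrank ℝ (LinearMap.range T) * hsInner D D ∧
      nuclearNorm T + nuclearNorm D₂ - nuclearNorm D₁ ≤ nuclearNorm (T + D) := by
  set U := LinearMap.range T with hU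
  set V := LinearMap.range (LinearMap.adjoint T) with hV
  let p : F →ₗ[ℝ] F := U.starProjection.toLinearMap
  let q : E →ₗ[ℝ] E := V.starProjection.toLinearMap
  let p' : F →ₗ[ℝ] F := Uᗮ.starProjection.toLinearMap
  let q' : E →ₗ[ℝ] E := Vᗮ.starProjection.toLinearMap
  have hpp : ∀ y, p y + p' y = y := fun y => U.starProjection_add_starProjection_orthogonal y
  have hqq : ∀ x, q x + q' x = x := fun x => V.starProjection_add_starProjection_orthogonal x
  have hp'adj : LinearMap.adjoint p' = p' :=
    ((LinearMap.isSymmetric_iff_isSelfAdjoint _).1 Uᗮ.starProjection_isSymmetric)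
  have hq'adj : LinearMap.adjoint q' = q' :=
    ((LinearMap.isSymmetric_iff_isSelfAdjoint _).1 Vᗮ.starProjection_isSymmetric)
  have hp'p' : ∀ y, p' (p' y) = p' y := fun y => by
    exact Submodule.starProjection_eq_self_iff.2 (Submodule.starProjection_apply_mem _ _)
  have hq'q' : ∀ x, q' (q' x) = q' x := fun x => by
    exact Submodule.starProjection_eq_self_iff.2 (Submodule.starProjection_apply_mem _ _)
  have hq'q : ∀ x, q' (q x) = 0 := fun x => by
    have := hqq (q' x)
    have h1 : q (q x) = q x :=
      Submodule.starProjection_eq_self_iff.2 (Submodule.starProjection_apply_mem _ _)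
    have h2 := hqq (q x)
    rw [h1] at h2
    simpa using h2
  have hp'U : ∀ y z, z ∈ U → inner ℝ (p' y) z = 0 := fun y z hz =>
    Submodule.inner_left_of_mem_orthogonal hz (Submodule.starProjection_apply_mem _ _)
  have hTq' : ∀ x, T (q' x) = 0 := fun x => by
    have hx : q' x ∈ Vᗮ := Submodule.starProjection_apply_mem _ _
    rw [← inner_self_eq_zero (𝕜 := ℝ), ← LinearMap.adjoint_inner_left]
    exact Submodule.inner_right_of_mem_orthogonal (LinearMap.mem_range_self _ _) hx
  set D₂ : E →ₗ[ℝ] F := p' ∘ₗ D ∘ₗ q' with hD₂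
  obtain ⟨W, hW1, hWT, hWr, hWk⟩ := exists_hsInner_eq_nuclearNorm T
  obtain ⟨Z, hZ1, hZD, hZr, hZk⟩ := exists_hsInner_eq_nuclearNorm D₂
  have hD₂D₂ : hsInner D₂ D₂ = hsInner D₂ D := by
    have hfix : p' ∘ₗ D₂ ∘ₗ q' = D₂ := by
      ext x
      simp [hD₂, hp'p', hq'q']
    have h := hsInner_comp_comp hp'adj hq'adj D D₂
    rwa [← hD₂, hfix, hsInner_comm D] at h
  have hZp : ∀ x, p' (Z x) = Z x := fun x => by
    obtain ⟨y, hy⟩ := hZr x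
    rw [← hy]
    exact hp'p' _
  have hZq : ∀ x, Z (q' x) = Z x := fun x => by
    have h0 : Z (q x) = 0 := hZk _ (by simp [hD₂, hq'q])
    conv_rhs => rw [← hqq x, map_add, h0, zero_add]
  have hWq : ∀ x, W (q x) = W x := fun x => by
    have h0 : W (q' x) = 0 := hWk _ (hTq' x)
    conv_rhs => rw [← hqq x, map_add, h0, add_zero]
  have hZW : ∀ x y, inner ℝ (Z x) (W y) = 0 := fun x y => by
    rw [← hZp]; exact hp'U _ _ (hWr y)
  refine ⟨D - D₂, D₂, by abel, ?_, ?_⟩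
  · refine (nuclearNorm_sq_le_rank_mul _).trans ?_
    have hnorm : hsInner (D - D₂) (D - D₂) ≤ hsInner D D := by
      have h1 : hsInner (D - D₂) (D - D₂) =
          hsInner D D - 2 * hsInner D₂ D + hsInner D₂ D₂ := by
        rw [sub_eq_add_neg, hsInner_add_left, hsInner_add_right, hsInner_add_right,
          hsInner_neg_left, hsInner_comm D (-D₂), hsInner_neg_left, hsInner_neg_left,
          hsInner_comm D₂ (-D₂), hsInner_neg_left]
        ring
      have h2 := hsInner_self_nonneg D₂
      rw [h1]
      linarith
    have hrank : finrank ℝ (LinearMap.range (D - D₂)) ≤ 2 * finrank ℝ U := by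
      have hsub : LinearMap.range (D - D₂) ≤ U ⊔ V.map (p' ∘ₗ D) := by
        rintro _ ⟨x, rfl⟩
        have : (D - D₂) x = p (D x) + p' (D (q x)) := by
          have h1 := hpp (D x)
          have h2 : D (q x) = D x - D (q' x) := by
            conv_rhs => rw [← hqq x, map_add]
            simp [hq'q', hq'q]
          rw [LinearMap.sub_apply, h2, map_sub]
          conv_lhs => rw [← h1]
          simp [hD₂]
          abel
        rw [this]
        refine Submodule.add_mem_sup (Submodule.starProjection_apply_mem _ _) ?_
        exact ⟨q x, Submodule.starProjection_apply_mem _ _, rfl⟩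
      calc _ ≤ finrank ℝ (U ⊔ V.map (p' ∘ₗ D) : Submodule ℝ F) := Submodule.finrank_mono hsub
        _ ≤ finrank ℝ U + finrank ℝ (V.map (p' ∘ₗ D)) :=
            Submodule.finrank_add_le_finrank_add_finrank _ _
        _ ≤ finrank ℝ U + finrank ℝ V := by gcongr; exact Submodule.finrank_map_le _ _
        _ = _ := by rw [hV, LinearMap.finrank_range_adjoint]; ring
    have hrank' : (finrank ℝ (LinearMap.range (D - D₂)) : ℝ) ≤ 2 * finrank ℝ U := by
      exact_mod_cast hrank
    exact mul_le_mul hrank' hnorm (hsInner_self_nonneg _) (by positivity)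
  · have hcontr : ∀ x, ‖(W + Z) x‖ ≤ 1 * ‖x‖ := fun x => by
      refine le_of_sq_le_sq ?_ (by positivity)
      have horth : inner ℝ (W x) (Z x) = 0 := by rw [real_inner_comm]; exact hZW x x
      have hx : ‖x‖ ^ 2 = ‖q x‖ ^ 2 + ‖q' x‖ ^ 2 := by
        have h0 : inner ℝ (q x) (q' x) = 0 := Submodule.inner_right_of_mem_orthogonal
          (Submodule.starProjection_apply_mem V x) (Submodule.starProjection_apply_mem Vᗮ x)
        conv_lhs => rw [← hqq x, norm_add_sq_real, h0]
        ring
      rw [LinearMap.add_apply, norm_add_sq_real, horth, one_mul, hx, ← hWq, ← hZq]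
      have h1 := pow_le_pow_left₀ (norm_nonneg _) (hW1 (q x)) 2
      have h2 := pow_le_pow_left₀ (norm_nonneg _) (hZ1 (q' x)) 2
      linarith
    have hmain := hsInner_le_mul_nuclearNorm hcontr (T + D)
    have hZT : hsInner Z T = 0 := hsInner_eq_zero_of_inner fun x => by
      rw [← hZp]; exact hp'U _ _ (LinearMap.mem_range_self _ _)
    have hWD : hsInner W D = hsInner W (D - D₂) := by
      have h0 : hsInner W D₂ = 0 := hsInner_eq_zero_of_inner fun x => by
        rw [real_inner_comm]; exact hp'U _ _ (hWr x)
      conv_lhs => rw [show D = (D - D₂) + D₂ by abel, hsInner_add_right, h0, add_zero]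
    have hZDD : hsInner Z D = nuclearNorm D₂ := by
      rw [← hZD, hD₂, ← hsInner_comp_comp hp'adj hq'adj]
      congr 1
      ext x
      simp [hZp, hZq]
    have hWneg : -nuclearNorm (D - D₂) ≤ hsInner W (D - D₂) := by
      have := hsInner_le_mul_nuclearNorm (S := -W) (C := 1) (fun x => by simpa using hW1 x) (D - D₂)
      rw [hsInner_neg_left] at this
      linarith
    rw [hsInner_add_left, hsInner_add_right, hsInner_add_right, hWT, hZT, hWD, hZDD] at hmain
    linarith

end Operators

/-! ### Averages over finite samples -/

section FiniteSamples

variable {K : Type*} [Fintype K]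

/-- The expectation of `F` under `n` independent draws from the weights `p`. -/
noncomputable def sampleMean (p : K → ℝ) (n : ℕ) (F : (Fin n → K) → ℝ) : ℝ :=
  ∑ x : Fin n → K, (∏ i, p (x i)) * F x

theorem sampleMean_succ (p : K → ℝ) {n : ℕ} (F : (Fin (n + 1) → K) → ℝ) :
    sampleMean p (n + 1) F = ∑ a, p a * sampleMean p n fun x => F (Fin.cons a x) := by
  simp only [sampleMean, Finset.mul_sum]
  rw [← Fintype.sum_prod_type', ← (Fin.consEquiv fun _ : Fin (n + 1) => K).sum_comp]
  refine Finset.sum_congr rfl fun y _ => ?_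
  simp [Fin.prod_univ_succ, Fin.consEquiv, mul_assoc]

theorem sampleMean_mono {p : K → ℝ} (hp : ∀ a, 0 ≤ p a) {n : ℕ} {F G : (Fin n → K) → ℝ}
    (h : ∀ x, F x ≤ G x) : sampleMean p n F ≤ sampleMean p n G :=
  Finset.sum_le_sum fun x _ =>
    mul_le_mul_of_nonneg_left (h x) (Finset.prod_nonneg fun _ _ => hp _)

theorem sampleMean_mul_const (p : K → ℝ) {n : ℕ} (F : (Fin n → K) → ℝ) (c : ℝ) :
    sampleMean p n (fun x => F x * c) = sampleMean p n F * c := by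
  simp only [sampleMean, Finset.sum_mul, mul_assoc]

theorem sampleMean_sub (p : K → ℝ) {n : ℕ} (F G : (Fin n → K) → ℝ) :
    sampleMean p n (fun x => F x - G x) = sampleMean p n F - sampleMean p n G := by
  simp only [sampleMean, ← Finset.sum_sub_distrib, mul_sub]

theorem sampleMean_const {p : K → ℝ} (hp1 : ∑ a, p a = 1) (n : ℕ) (c : ℝ) :
    sampleMean p n (fun _ => c) = c := by
  classical
  have h : ∑ x : Fin n → K, ∏ i, p (x i) = 1 := by
    rw [← Fintype.piFinset_univ, ← Finset.prod_univ_sum]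
    simp [hp1]
  rw [sampleMean, ← Finset.sum_mul, h, one_mul]

theorem sampleMean_sum_comm (p : K → ℝ) {n : ℕ} {ι : Type*} [Fintype ι] (w : ι → ℝ)
    (F : ι → (Fin n → K) → ℝ) :
    ∑ i, w i * sampleMean p n (F i) = sampleMean p n fun x => ∑ i, w i * F i x := by
  simp only [sampleMean, Finset.mul_sum]
  rw [Finset.sum_comm]
  exact Finset.sum_congr rfl fun x _ => Finset.sum_congr rfl fun i _ => by ring

theorem abs_sampleMean_sub_le {p : K → ℝ} (hp : ∀ a, 0 ≤ p a) (hp1 : ∑ a, p a = 1) {n : ℕ}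
    {F G : (Fin n → K) → ℝ} {c : ℝ} (h : ∀ x, |F x - G x| ≤ c) :
    |sampleMean p n F - sampleMean p n G| ≤ c := by
  rw [← sampleMean_sub, abs_le]
  have h1 := sampleMean_mono hp (n := n) fun x => (abs_le.1 (h x)).1
  have h2 := sampleMean_mono hp (n := n) fun x => (abs_le.1 (h x)).2
  rw [sampleMean_const hp1] at h1 h2
  exact ⟨h1, h2⟩

/-! ### The bounded difference inequality -/

/-- Hoeffding's lemma, with the constant that the convexity of `exp` gives. -/
theorem sum_mul_exp_le_of_abs_le {p : K → ℝ} (hp : ∀ a, 0 ≤ p a) (hp1 : ∑ a, p a = 1)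
    {G : K → ℝ} (hG : ∑ a, p a * G a = 0) {c : ℝ} (hc : 0 < c) (hGc : ∀ a, |G a| ≤ c) (s : ℝ) :
    ∑ a, p a * Real.exp (s * G a) ≤ Real.exp (s ^ 2 * c ^ 2 / 2) := by
  have key : ∀ a, Real.exp (s * G a) ≤ Real.cosh (s * c) + G a * (Real.sinh (s * c) / c) := by
    intro a
    obtain ⟨h1, h2⟩ := abs_le.1 (hGc a)
    have hconv := convexOn_exp.2 (Set.mem_univ (s * c)) (Set.mem_univ (-(s * c)))
      (show 0 ≤ (c + G a) / (2 * c) from div_nonneg (by linarith) (by linarith))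
      (show 0 ≤ (c - G a) / (2 * c) from div_nonneg (by linarith) (by linarith))
      (by field_simp; ring)
    simp only [smul_eq_mul] at hconv
    have e1 : (c + G a) / (2 * c) * (s * c) + (c - G a) / (2 * c) * -(s * c) = s * G a := by
      field_simp
      ring
    rw [e1] at hconv
    refine hconv.trans (le_of_eq ?_)
    rw [Real.cosh_eq, Real.sinh_eq]
    field_simp
    ring
  calc ∑ a, p a * Real.exp (s * G a)
      ≤ ∑ a, p a * (Real.cosh (s * c) + G a * (Real.sinh (s * c) / c)) :=
        Finset.sum_le_sum fun a _ => mul_le_mul_of_nonneg_left (key a) (hp a)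
    _ = Real.cosh (s * c) := by
        simp only [mul_add, Finset.sum_add_distrib, ← Finset.sum_mul, hp1, ← mul_assoc, hG]
        ring
    _ ≤ _ := by
        refine (Real.cosh_le_exp_half_sq _).trans (le_of_eq ?_)
        rw [mul_pow]

/-- The exponential moment behind McDiarmid's inequality, by conditioning on one draw at a
time. -/
theorem sampleMean_exp_le {p : K → ℝ} (hp : ∀ a, 0 ≤ p a) (hp1 : ∑ a, p a = 1) {c : ℝ}
    (hc : 0 < c) (s : ℝ) (n : ℕ) (F : (Fin n → K) → ℝ)
    (hF : ∀ x i a, |F (Function.update x i a) - F x| ≤ c) :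
    sampleMean p n (fun x => Real.exp (s * (F x - sampleMean p n F))) ≤
      Real.exp (n * (s ^ 2 * c ^ 2 / 2)) := by
  induction n with
  | zero => simp [sampleMean, Subsingleton.elim _ (default : Fin 0 → K)]
  | succ n ih =>
    set G : K → ℝ := fun a => sampleMean p n fun x => F (Fin.cons a x) with hGdef
    set m := sampleMean p (n + 1) F with hm
    have hmG : m = ∑ b, p b * G b := sampleMean_succ p F
    have hdiff : ∀ a b, |G a - G b| ≤ c := fun a b => abs_sampleMean_sub_le hp hp1 fun x => by
      have := hF (Fin.cons b x) 0 a
      rwa [Fin.update_cons_zero] at this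
    have hcent : ∀ a, G a - m = ∑ b, p b * (G a - G b) := fun a => by
      simp only [mul_sub, Finset.sum_sub_distrib, ← Finset.sum_mul, hp1, hmG, one_mul]
    have hGm : ∀ a, |G a - m| ≤ c := fun a => by
      rw [hcent]
      refine (Finset.abs_sum_le_sum_abs _ _).trans ?_
      calc ∑ b, |p b * (G a - G b)| ≤ ∑ b, p b * c := Finset.sum_le_sum fun b _ => by
            rw [abs_mul, abs_of_nonneg (hp b)]
            exact mul_le_mul_of_nonneg_left (hdiff a b) (hp b)
        _ = c := by rw [← Finset.sum_mul, hp1, one_mul]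
    have hzero : ∑ a, p a * (G a - m) = 0 := by
      simp only [mul_sub, Finset.sum_sub_distrib, ← Finset.sum_mul, hp1, hmG, one_mul, sub_self]
    have hIH : ∀ a, sampleMean p n (fun x => Real.exp (s * (F (Fin.cons a x) - G a))) ≤
        Real.exp (n * (s ^ 2 * c ^ 2 / 2)) := fun a => ih (fun x => F (Fin.cons a x))
      fun x i b => by
        have := hF (Fin.cons a x) i.succ b
        rwa [← Fin.cons_update] at this
    rw [sampleMean_succ]
    calc _ = ∑ a, p a * Real.exp (s * (G a - m)) *
            sampleMean p n (fun x => Real.exp (s * (F (Fin.cons a x) - G a))) := by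
          refine Finset.sum_congr rfl fun a _ => ?_
          rw [mul_assoc, mul_comm (Real.exp _), ← sampleMean_mul_const]
          congr 2
          ext x
          rw [← Real.exp_add]
          ring_nf
      _ ≤ ∑ a, p a * Real.exp (s * (G a - m)) * Real.exp (n * (s ^ 2 * c ^ 2 / 2)) :=
          Finset.sum_le_sum fun a _ => mul_le_mul_of_nonneg_left (hIH a)
            (mul_nonneg (hp a) (Real.exp_pos _).le)
      _ ≤ Real.exp (s ^ 2 * c ^ 2 / 2) * Real.exp (n * (s ^ 2 * c ^ 2 / 2)) := by
          rw [← Finset.sum_mul]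
          exact mul_le_mul_of_nonneg_right (sum_mul_exp_le_of_abs_le hp hp1 hzero hc hGm s)
            (Real.exp_pos _).le
      _ = _ := by
          rw [← Real.exp_add]
          push_cast
          ring_nf

open Classical in
/-- McDiarmid's bounded difference inequality. -/
theorem sampleMean_tail_le {p : K → ℝ} (hp : ∀ a, 0 ≤ p a) (hp1 : ∑ a, p a = 1) {c : ℝ}
    (hc : 0 < c) {n : ℕ} (hn : 0 < n) (F : (Fin n → K) → ℝ)
    (hF : ∀ x i a, |F (Function.update x i a) - F x| ≤ c) {t : ℝ} (ht : 0 ≤ t) :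
    sampleMean p n (fun x => if sampleMean p n F + t ≤ F x then 1 else 0) ≤
      Real.exp (-(t ^ 2 / (2 * n * c ^ 2))) := by
  have hn' : (0 : ℝ) < n := by exact_mod_cast hn
  -- the minimiser of the Chernoff bound
  set s := t / (n * c ^ 2) with hs
  have hs0 : 0 ≤ s := by positivity
  calc _ ≤ sampleMean p n
          (fun x => Real.exp (s * (F x - sampleMean p n F)) * Real.exp (-(s * t))) := by
        refine sampleMean_mono hp fun x => ?_
        rw [← Real.exp_add]
        split_ifs with h
        · refine Real.one_le_exp ?_
          nlinarith
        · exact (Real.exp_pos _).le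
    _ ≤ Real.exp (n * (s ^ 2 * c ^ 2 / 2)) * Real.exp (-(s * t)) := by
        rw [sampleMean_mul_const]
        exact mul_le_mul_of_nonneg_right (sampleMean_exp_le hp hp1 hc s n F hF) (Real.exp_pos _).le
    _ = _ := by
        rw [← Real.exp_add]
        congr 1
        rw [hs]
        field_simp
        ring

/-! ### Symmetrization and contraction -/

/-- The sign encoded by a Boolean. -/
def boolSign (b : Bool) : ℝ := if b then 1 else -1

/-- The weights of a draw from `p` together with an independent Rademacher sign. -/
noncomputable def signedWeight (p : K → ℝ) (z : K × Bool) : ℝ := p z.1 / 2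

theorem bddAbove_range_of_abs_le {T : Type*} {f : T → ℝ} {C : ℝ} (h : ∀ t, |f t| ≤ C) :
    BddAbove (Set.range f) :=
  ⟨C, by rintro _ ⟨t, rfl⟩; exact (le_abs_self _).trans (h t)⟩

/-- Symmetrization and contraction of the square, in a single coordinate and with an arbitrary
offset `h`. -/
theorem sum_iSup_sq_le {p : K → ℝ} (hp : ∀ a, 0 ≤ p a) (hp1 : ∑ a, p a = 1) {T : Type*}
    [Nonempty T] (f : T → K → ℝ) (hf : ∀ t a, |f t a| ≤ 1) (h : T → ℝ) {C : ℝ}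
    (hC : ∀ t, |h t| ≤ C) :
    ∑ a, p a * ⨆ t, (h t + (∑ b, p b * f t b ^ 2 - f t a ^ 2)) ≤
      ∑ z, signedWeight p z * ⨆ t, (h t + 4 * (boolSign z.2 * f t z.1)) := by
  have hsq : ∀ t a, 0 ≤ f t a ^ 2 ∧ f t a ^ 2 ≤ 1 := fun t a =>
    ⟨sq_nonneg _, (sq_le_one_iff_abs_le_one _).2 (hf t a)⟩
  set Φ : K → K → ℝ := fun a b => ⨆ t, (h t + (f t b ^ 2 - f t a ^ 2)) with hΦ
  have hΦb : ∀ a b, BddAbove (Set.range fun t => h t + (f t b ^ 2 - f t a ^ 2)) := fun a b =>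
    bddAbove_range_of_abs_le (C := C + 1) fun t => by
      refine (abs_add_le _ _).trans (add_le_add (hC t) (abs_le.2 ?_))
      constructor <;> linarith [hsq t a, hsq t b]
  set G : K → ℝ := fun a => (⨆ t, (h t + 4 * f t a)) + ⨆ t, (h t + 4 * (-f t a)) with hG
  have hGb : ∀ a, BddAbove (Set.range fun t => h t + 4 * f t a) := fun a =>
    bddAbove_range_of_abs_le (C := C + 4) fun t => by
      refine (abs_add_le _ _).trans (add_le_add (hC t) ?_)
      rw [abs_mul]
      norm_num
      exact hf t a
  have hGb' : ∀ a, BddAbove (Set.range fun t => h t + 4 * (-f t a)) := fun a =>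
    bddAbove_range_of_abs_le (C := C + 4) fun t => by
      refine (abs_add_le _ _).trans (add_le_add (hC t) ?_)
      rw [abs_mul, abs_neg]
      norm_num
      exact hf t a
  have hghost : ∀ a, (⨆ t, (h t + (∑ b, p b * f t b ^ 2 - f t a ^ 2))) ≤ ∑ b, p b * Φ a b := by
    refine fun a => ciSup_le fun t => ?_
    calc h t + (∑ b, p b * f t b ^ 2 - f t a ^ 2)
        = ∑ b, p b * (h t + (f t b ^ 2 - f t a ^ 2)) := by
          simp only [mul_add, mul_sub, Finset.sum_add_distrib, Finset.sum_sub_distrib,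
            ← Finset.sum_mul, hp1, one_mul]
      _ ≤ _ := Finset.sum_le_sum fun b _ =>
          mul_le_mul_of_nonneg_left (le_ciSup (hΦb a b) t) (hp b)
  -- `u ↦ u ^ 2` is `2`-Lipschitz on `[-1, 1]`
  have hlip : ∀ a s t, f s a ^ 2 - f t a ^ 2 ≤ 2 * |f s a - f t a| := fun a s t => by
    have h1 := abs_le.1 (hf s a)
    have h2 := abs_le.1 (hf t a)
    rcases abs_cases (f s a - f t a) with h3 | h3 <;> nlinarith
  have habs : ∀ a s t, h s + h t + 4 * |f s a - f t a| ≤ G a := fun a s t => by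
    have h1 := le_ciSup (hGb a) s
    have h2 := le_ciSup (hGb' a) t
    have h3 := le_ciSup (hGb a) t
    have h4 := le_ciSup (hGb' a) s
    simp only [hG]
    rcases abs_cases (f s a - f t a) with h5 | h5 <;> linarith
  have hpair : ∀ a b, Φ a b + Φ b a ≤ (G a + G b) / 2 := fun a b => by
    refine ciSup_add_ciSup_le fun s t => ?_
    have h1 := hlip b s t
    have h2 := hlip a t s
    rw [abs_sub_comm] at h2
    linarith [habs a s t, habs b s t]
  have hswap : ∑ a, ∑ b, p a * p b * Φ a b = ∑ a, ∑ b, p a * p b * Φ b a := by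
    rw [Finset.sum_comm]
    exact Finset.sum_congr rfl fun a _ => Finset.sum_congr rfl fun b _ => by ring
  have hright : ∑ a, ∑ b, p a * p b * ((G a + G b) / 2) = ∑ a, p a * G a := by
    have e1 : ∀ a, ∑ b, p a * p b * ((G a + G b) / 2) =
        (p a * G a + p a * ∑ b, p b * G b) / 2 := fun a => by
      have : ∑ b, p a * p b * ((G a + G b) / 2) =
          (p a * G a * ∑ b, p b + p a * ∑ b, p b * G b) / 2 := by
        rw [Finset.mul_sum, Finset.mul_sum, ← Finset.sum_add_distrib, Finset.sum_div]
        exact Finset.sum_congr rfl fun b _ => by ring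
      rw [this, hp1, mul_one]
    simp only [e1]
    rw [← Finset.sum_div, Finset.sum_add_distrib, ← Finset.sum_mul, hp1]
    ring
  have hRHS : ∑ z, signedWeight p z * ⨆ t, (h t + 4 * (boolSign z.2 * f t z.1)) =
      (∑ a, p a * G a) / 2 := by
    rw [Fintype.sum_prod_type, Finset.sum_div]
    refine Finset.sum_congr rfl fun a _ => ?_
    simp [signedWeight, boolSign, hG]
    ring
  have hleft : ∑ a, p a * ⨆ t, (h t + (∑ b, p b * f t b ^ 2 - f t a ^ 2)) ≤
      ∑ a, ∑ b, p a * p b * Φ a b := by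
    refine Finset.sum_le_sum fun a _ => ?_
    refine (mul_le_mul_of_nonneg_left (hghost a) (hp a)).trans (le_of_eq ?_)
    rw [Finset.mul_sum]
    exact Finset.sum_congr rfl fun b _ => by ring
  have hsum : ∑ a, ∑ b, p a * p b * Φ a b + ∑ a, ∑ b, p a * p b * Φ b a ≤
      ∑ a, ∑ b, p a * p b * ((G a + G b) / 2) := by
    simp only [← Finset.sum_add_distrib, ← mul_add]
    exact Finset.sum_le_sum fun a _ => Finset.sum_le_sum fun b _ =>
      mul_le_mul_of_nonneg_left (hpair a b) (mul_nonneg (hp a) (hp b))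
  rw [hRHS]
  linarith

/-- Symmetrization and contraction of the square for the empirical process. The offset `h` makes
the induction on the number of draws possible. -/
theorem sampleMean_iSup_sq_le {p : K → ℝ} (hp : ∀ a, 0 ≤ p a) (hp1 : ∑ a, p a = 1) {T : Type*}
    [Nonempty T] (f : T → K → ℝ) (hf : ∀ t a, |f t a| ≤ 1) (n : ℕ) (h : T → ℝ) {C : ℝ}
    (hC : ∀ t, |h t| ≤ C) :
    sampleMean p n (fun x => ⨆ t, (h t + ∑ i, (∑ b, p b * f t b ^ 2 - f t (x i) ^ 2))) ≤
      sampleMean (signedWeight p) n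
        (fun z => ⨆ t, (h t + 4 * ∑ i, boolSign (z i).2 * f t (z i).1)) := by
  have hsw : ∀ z, 0 ≤ signedWeight p z := fun z => div_nonneg (hp _) two_pos.le
  have hsq : ∀ t a, 0 ≤ f t a ^ 2 ∧ f t a ^ 2 ≤ 1 := fun t a =>
    ⟨sq_nonneg _, (sq_le_one_iff_abs_le_one _).2 (hf t a)⟩
  have hPsq : ∀ t, 0 ≤ ∑ b, p b * f t b ^ 2 ∧ ∑ b, p b * f t b ^ 2 ≤ 1 := fun t =>
    ⟨Finset.sum_nonneg fun b _ => mul_nonneg (hp b) (sq_nonneg _), by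
      rw [← hp1]
      exact Finset.sum_le_sum fun b _ => mul_le_of_le_one_right (hp b) (hsq t b).2⟩
  induction n generalizing h C with
  | zero => simp [sampleMean]
  | succ n ih =>
    rw [sampleMean_succ, sampleMean_succ]
    calc _ ≤ ∑ a, p a * sampleMean (signedWeight p) n (fun z =>
            ⨆ t, (h t + (∑ b, p b * f t b ^ 2 - f t a ^ 2) +
              4 * ∑ i, boolSign (z i).2 * f t (z i).1)) := by
          refine Finset.sum_le_sum fun a _ => mul_le_mul_of_nonneg_left ?_ (hp a)
          refine le_trans (le_of_eq ?_) (ih (fun t => h t + (∑ b, p b * f t b ^ 2 - f t a ^ 2))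
            (C := C + 1) fun t => ?_)
          · congr 1
            ext x
            simp only [Fin.sum_univ_succ, Fin.cons_zero, Fin.cons_succ, add_assoc]
          · refine (abs_add_le _ _).trans (add_le_add (hC t) (abs_le.2 ?_))
            constructor <;> linarith [hsq t a, hPsq t]
      _ = sampleMean (signedWeight p) n (fun z => ∑ a, p a *
            ⨆ t, ((h t + 4 * ∑ i, boolSign (z i).2 * f t (z i).1) +
              (∑ b, p b * f t b ^ 2 - f t a ^ 2))) := by
          rw [sampleMean_sum_comm]
          simp only [add_right_comm]
      _ ≤ sampleMean (signedWeight p) n (fun z => ∑ y, signedWeight p y *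
            ⨆ t, ((h t + 4 * ∑ i, boolSign (z i).2 * f t (z i).1) +
              4 * (boolSign y.2 * f t y.1))) := by
          refine sampleMean_mono hsw fun z =>
            sum_iSup_sq_le hp hp1 f hf _ (C := C + 4 * n) fun t => ?_
          refine (abs_add_le _ _).trans (add_le_add (hC t) ?_)
          rw [abs_mul, abs_of_pos (by norm_num : (0 : ℝ) < 4)]
          refine mul_le_mul_of_nonneg_left ((Finset.abs_sum_le_sum_abs _ _).trans ?_) (by norm_num)
          calc _ ≤ ∑ _i : Fin n, (1 : ℝ) := Finset.sum_le_sum fun i _ => by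
                have hs : |boolSign (z i).2| = 1 := by
                  unfold boolSign; split_ifs <;> simp
                rw [abs_mul, hs, one_mul]
                exact hf _ _
            _ = n := by simp
      _ = _ := by
          rw [← sampleMean_sum_comm]
          refine Finset.sum_congr rfl fun y _ => ?_
          congr 2
          ext z
          congr 1
          ext t
          simp only [Fin.sum_univ_succ, Fin.cons_zero, Fin.cons_succ]
          ring

/-! ### Restricted strong convexity -/

open Classical in
/-- Restricted strong convexity. Consider functions with values in `[-1, 1]` whose signed
empirical sums are at most `N · M` times their `L²` norm. Those whose squared `L²` norm is at least
the threshold `θ²` simultaneously have empirical second moment at least half the true one, with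
high probability: both sides are homogeneous, so scaling reduces to squared `L²` norm exactly `θ²`,
and there the empirical process is controlled by symmetrization, contraction and bounded
differences. -/
theorem restricted_strong_convexity {p : K → ℝ} (hp : ∀ a, 0 ≤ p a) (hp1 : ∑ a, p a = 1)
    {n : ℕ} (hn : 0 < n) {D : ℝ} (hD : 1 ≤ D) (N : (Fin n → K × Bool) → ℝ) {M θ : ℝ}
    (hθ : 0 < θ)
    (hbig : 4 * (sampleMean (signedWeight p) n N * (M * θ)) + √(2 * n * Real.log D) ≤
      n * θ ^ 2 / 2) :
    1 - 1 / D ≤ sampleMean p n (fun x => if ∀ g : K → ℝ, (∀ a, |g a| ≤ 1) →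
      (∀ z : Fin n → K × Bool,
        ∑ i, boolSign (z i).2 * g (z i).1 ≤ N z * (M * √(∑ a, p a * g a ^ 2))) →
      θ ^ 2 ≤ ∑ a, p a * g a ^ 2 →
      n * (∑ a, p a * g a ^ 2) / 2 ≤ ∑ i, g (x i) ^ 2 then 1 else 0) := by
  let T := {g : K → ℝ // (∀ a, |g a| ≤ 1) ∧ (∀ z : Fin n → K × Bool,
    ∑ i, boolSign (z i).2 * g (z i).1 ≤ N z * (M * θ)) ∧ ∑ a, p a * g a ^ 2 = θ ^ 2}
  -- it is enough to treat the functions in `T`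
  have hscale : ∀ x : Fin n → K, (∀ g : T, n * θ ^ 2 / 2 ≤ ∑ i, g.1 (x i) ^ 2) →
      ∀ g : K → ℝ, (∀ a, |g a| ≤ 1) → (∀ z : Fin n → K × Bool,
        ∑ i, boolSign (z i).2 * g (z i).1 ≤ N z * (M * √(∑ a, p a * g a ^ 2))) →
      θ ^ 2 ≤ ∑ a, p a * g a ^ 2 → n * (∑ a, p a * g a ^ 2) / 2 ≤ ∑ i, g (x i) ^ 2 := by
    intro x hx g hg1 hgN hgθ
    set V := ∑ a, p a * g a ^ 2 with hV
    have hVpos : 0 < V := lt_of_lt_of_le (by positivity) hgθ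
    set τ := θ / √V with hτ
    have hsV : 0 < √V := Real.sqrt_pos.2 hVpos
    have hτ0 : 0 < τ := by positivity
    have hτ1 : τ ≤ 1 := (div_le_one hsV).2 (Real.le_sqrt_of_sq_le hgθ)
    have hτV : τ ^ 2 * V = θ ^ 2 := by
      rw [hτ, div_pow, Real.sq_sqrt hVpos.le]
      field_simp
    have h := hx ⟨fun a => τ * g a, fun a => by
        rw [abs_mul, abs_of_pos hτ0]
        exact mul_le_one₀ hτ1 (abs_nonneg _) (hg1 a), fun z => by
        calc ∑ i, boolSign (z i).2 * (τ * g (z i).1)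
            = τ * ∑ i, boolSign (z i).2 * g (z i).1 := by
              rw [Finset.mul_sum]
              exact Finset.sum_congr rfl fun i _ => by ring
          _ ≤ τ * (N z * (M * √V)) := mul_le_mul_of_nonneg_left (hgN z) hτ0.le
          _ = _ := by rw [hτ]; field_simp, by
        rw [← hτV, hV, Finset.mul_sum]
        exact Finset.sum_congr rfl fun a _ => by ring⟩
    have e : ∑ i, (τ * g (x i)) ^ 2 = τ ^ 2 * ∑ i, g (x i) ^ 2 := by
      rw [Finset.mul_sum]
      exact Finset.sum_congr rfl fun i _ => by ring
    simp only [e] at h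
    rw [← hτV] at h
    have hτ2 : 0 < τ ^ 2 := by positivity
    refine le_of_mul_le_mul_left (le_trans (le_of_eq ?_) h) hτ2
    ring
  have hn' : (0 : ℝ) < n := by exact_mod_cast hn
  rcases isEmpty_or_nonempty T with hT | hT
  · have : ∀ x : Fin n → K, ∀ g : T, n * θ ^ 2 / 2 ≤ ∑ i, g.1 (x i) ^ 2 := fun x g => hT.elim g
    simp only [if_pos (hscale _ (this _)), sampleMean_const hp1]
    have : 0 ≤ 1 / D := by positivity
    linarith
  set F : (Fin n → K) → ℝ := fun x => ⨆ g : T, ∑ i, (∑ b, p b * g.1 b ^ 2 - g.1 (x i) ^ 2) with hF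
  have hsq : ∀ (g : T) a, 0 ≤ g.1 a ^ 2 ∧ g.1 a ^ 2 ≤ 1 := fun g a =>
    ⟨sq_nonneg _, (sq_le_one_iff_abs_le_one _).2 (g.2.1 a)⟩
  have hFb : ∀ x : Fin n → K, BddAbove (Set.range fun g : T =>
      ∑ i, (∑ b, p b * g.1 b ^ 2 - g.1 (x i) ^ 2)) := fun x => by
    refine ⟨n * θ ^ 2, ?_⟩
    rintro _ ⟨g, rfl⟩
    calc ∑ i, (∑ b, p b * g.1 b ^ 2 - g.1 (x i) ^ 2) ≤ ∑ _i : Fin n, θ ^ 2 :=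
          Finset.sum_le_sum fun i _ => by rw [g.2.2.2]; linarith [hsq g (x i)]
      _ = _ := by simp
  have hFdiff' : ∀ (x y : Fin n → K) (i : Fin n),
      (∀ j, j ≠ i → x j = y j) → F x ≤ F y + 1 := fun x y i hxy => by
    refine ciSup_le fun g => ?_
    refine le_trans ?_ (add_le_add_left (le_ciSup (hFb y) g) 1)
    rw [← Finset.add_sum_erase _ _ (Finset.mem_univ i), ← Finset.add_sum_erase
      (f := fun i => ∑ b, p b * g.1 b ^ 2 - g.1 (y i) ^ 2) _ (Finset.mem_univ i)]
    have : ∑ j ∈ Finset.univ.erase i, (∑ b, p b * g.1 b ^ 2 - g.1 (x j) ^ 2) =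
        ∑ j ∈ Finset.univ.erase i, (∑ b, p b * g.1 b ^ 2 - g.1 (y j) ^ 2) :=
      Finset.sum_congr rfl fun j hj => by rw [hxy j (Finset.ne_of_mem_erase hj)]
    rw [this]
    linarith [hsq g (x i), hsq g (y i)]
  have hFdiff : ∀ x i a, |F (Function.update x i a) - F x| ≤ 1 := fun x i a => by
    rw [abs_le]
    have h1 := hFdiff' x (Function.update x i a) i fun j hj => by simp [hj]
    have h2 := hFdiff' (Function.update x i a) x i fun j hj => by simp [hj]
    constructor <;> linarith
  have hmean : sampleMean p n F ≤ 4 * (sampleMean (signedWeight p) n N * (M * θ)) := by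
    have h1 := sampleMean_iSup_sq_le hp hp1 (fun g : T => g.1) (fun g => g.2.1) n (fun _ => 0)
      (C := 0) (by simp)
    simp only [zero_add] at h1
    refine h1.trans ?_
    rw [mul_comm 4, ← sampleMean_mul_const, ← sampleMean_mul_const]
    refine sampleMean_mono (fun z => div_nonneg (hp _) two_pos.le) fun z => ciSup_le fun g => ?_
    linarith [g.2.2.1 z]
  set s := √(2 * n * Real.log D) with hs
  have hlog : 0 ≤ Real.log D := Real.log_nonneg hD
  have htail := sampleMean_tail_le hp hp1 one_pos hn F hFdiff (t := s) (Real.sqrt_nonneg _)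
  have hexp : Real.exp (-(s ^ 2 / (2 * n * 1 ^ 2))) = 1 / D := by
    rw [hs, Real.sq_sqrt (by positivity), one_pow, mul_one, mul_div_cancel_left₀ _ (by positivity),
      Real.exp_neg, Real.exp_log (by linarith), one_div]
  rw [hexp] at htail
  have hone := sampleMean_const hp1 n 1
  refine le_trans (sub_le_sub_left htail 1) ?_
  refine le_trans (le_of_eq (by rw [sampleMean_sub, hone])) (sampleMean_mono hp
    (F := fun x => 1 - if sampleMean p n F + s ≤ F x then 1 else 0) fun x => ?_)
  by_cases hx : sampleMean p n F + s ≤ F x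
  · rw [if_pos hx, sub_self]
    split_ifs <;> norm_num
  · rw [if_neg hx, if_pos (hscale x fun g => ?_), sub_zero]
    have h1 : ∑ i, (∑ b, p b * g.1 b ^ 2 - g.1 (x i) ^ 2) ≤ F x := le_ciSup (hFb x) g
    rw [g.2.2.2, Finset.sum_sub_distrib, Finset.sum_const, Finset.card_univ, Fintype.card_fin,
      nsmul_eq_mul] at h1
    linarith

end FiniteSamples

/-! ### Matrix norms as operator norms -/

section Matrices

open Module

variable {m₁ m₂ : ℕ}

theorem hsInner_toEuclideanLin (A B : Matrix (Fin m₁) (Fin m₂) ℝ) :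
    hsInner (Matrix.toEuclideanLin A) (Matrix.toEuclideanLin B) = ∑ j, ∑ k, A j k * B j k := by
  rw [hsInner_eq_sum _ _ (EuclideanSpace.basisFun (Fin m₂) ℝ), Finset.sum_comm]
  refine Finset.sum_congr rfl fun k _ => ?_
  simp [PiLp.inner_apply, Matrix.toLpLin_apply, mul_comm]

theorem scalarProd_eq_sum (A B : Matrix (Fin m₁) (Fin m₂) ℝ) :
    scalarProd A B = ∑ j, ∑ k, A j k * B j k := by
  rw [scalarProd, Finset.sum_comm]
  simp [Matrix.trace, Matrix.mul_apply]

theorem scalarProd_eq_hsInner (A B : Matrix (Fin m₁) (Fin m₂) ℝ) :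
    scalarProd A B = hsInner (Matrix.toEuclideanLin A) (Matrix.toEuclideanLin B) := by
  rw [hsInner_toEuclideanLin, scalarProd_eq_sum]

theorem finrank_range_toEuclideanLin (A : Matrix (Fin m₁) (Fin m₂) ℝ) :
    finrank ℝ (LinearMap.range (Matrix.toEuclideanLin A)) = A.rank := by
  rw [Matrix.toEuclideanLin, Matrix.toLpLin_eq_toLin]
  exact (Matrix.rank_eq_finrank_range_toLin A _ _).symm

theorem sum_singularValue_eq {g : ℝ → ℝ} (hg : g 0 = 0) (A : Matrix (Fin m₁) (Fin m₂) ℝ) :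
    ∑ j ∈ Finset.range (min m₁ m₂), g (singularValue A j) =
      ∑ i : Fin (finrank ℝ (EuclideanSpace ℝ (Fin m₂))),
        g ((Matrix.toEuclideanLin A).singularValues i) := by
  have h := finrank_range_toEuclideanLin A
  rw [Fin.sum_univ_eq_sum_range fun i => g ((Matrix.toEuclideanLin A).singularValues i),
    sum_singularValues_eq_sum_range (Matrix.toEuclideanLin A) hg (LinearMap.finrank_range_le _)]
  refine sum_singularValues_eq_sum_range (Matrix.toEuclideanLin A) hg ?_
  rw [h]
  exact le_min (by simpa using A.rank_le_height) (by simpa using A.rank_le_width)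

theorem schattenNorm_one_eq (A : Matrix (Fin m₁) (Fin m₂) ℝ) :
    schattenNorm 1 A = nuclearNorm (Matrix.toEuclideanLin A) := by
  simp only [schattenNorm, Real.rpow_one, div_one]
  exact sum_singularValue_eq (g := fun x => x) rfl A

theorem schattenNorm_two_sq (A : Matrix (Fin m₁) (Fin m₂) ℝ) :
    schattenNorm 2 A ^ 2 = scalarProd A A := by
  have h : ∑ j ∈ Finset.range (min m₁ m₂), singularValue A j ^ (2 : ℝ) = scalarProd A A := by
    simp only [Real.rpow_two]
    rw [scalarProd_eq_hsInner, hsInner_self_eq_sum_singularValues]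
    exact sum_singularValue_eq (g := fun x => x ^ 2) (by simp) A
  rw [schattenNorm, h, ← Real.sqrt_eq_rpow, Real.sq_sqrt]
  rw [scalarProd_eq_hsInner]
  exact hsInner_self_nonneg _

theorem specNorm_nonneg (A : Matrix (Fin m₁) (Fin m₂) ℝ) : 0 ≤ specNorm A :=
  LinearMap.singularValues_nonneg _ _

theorem scalarProd_le_specNorm_mul (S A : Matrix (Fin m₁) (Fin m₂) ℝ) :
    scalarProd S A ≤ specNorm S * schattenNorm 1 A := by
  rw [scalarProd_eq_hsInner, schattenNorm_one_eq]
  exact hsInner_le_mul_nuclearNorm (norm_map_le_singularValues_zero _) _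

theorem scalarProd_sub_right (S A B : Matrix (Fin m₁) (Fin m₂) ℝ) :
    scalarProd S (A - B) = scalarProd S A - scalarProd S B := by
  simp [scalarProd, Matrix.mul_sub]

theorem scalarProd_weightedMean {n : ℕ} (w : Fin n → ℝ)
    (x : Fin n → Matrix (Fin m₁) (Fin m₂) ℝ) (A : Matrix (Fin m₁) (Fin m₂) ℝ) :
    scalarProd (weightedMean w x) A = (1 / (n : ℝ)) * ∑ i, w i * scalarProd (x i) A := by
  simp [scalarProd, weightedMean, Matrix.transpose_sum, Matrix.sum_mul, Matrix.trace_sum]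

theorem scalarProd_single (j : Fin m₁) (k : Fin m₂) (A : Matrix (Fin m₁) (Fin m₂) ℝ) :
    scalarProd (Matrix.single j k 1) A = A j k := by
  simp [scalarProd, Matrix.trace_single_mul]

/-- Decomposability of the nuclear norm at `A`, in terms of the nuclear norms `u` and `v` of the
two parts of the perturbation `D`. -/
theorem exists_schattenNorm_decomposition (A D : Matrix (Fin m₁) (Fin m₂) ℝ) :
    ∃ u v : ℝ, 0 ≤ u ∧ 0 ≤ v ∧ u ^ 2 ≤ 2 * A.rank * schattenNorm 2 D ^ 2 ∧
      schattenNorm 1 A + v - u ≤ schattenNorm 1 (A + D) ∧ schattenNorm 1 D ≤ u + v := by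
  obtain ⟨D₁, D₂, hD, h1, h2⟩ := exists_nuclearNorm_decomposition (Matrix.toEuclideanLin A)
    (Matrix.toEuclideanLin D)
  refine ⟨nuclearNorm D₁, nuclearNorm D₂, nuclearNorm_nonneg _, nuclearNorm_nonneg _, ?_, ?_, ?_⟩
  · rwa [schattenNorm_two_sq, scalarProd_eq_hsInner, ← finrank_range_toEuclideanLin]
  · rwa [schattenNorm_one_eq, schattenNorm_one_eq, map_add]
  · obtain ⟨W, hW, hWD, -⟩ := exists_hsInner_eq_nuclearNorm (Matrix.toEuclideanLin D)
    have hW' : ∀ x, ‖W x‖ ≤ 1 * ‖x‖ := by simpa using hW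
    rw [schattenNorm_one_eq, ← hWD, hD, hsInner_add_right]
    linarith [hsInner_le_mul_nuclearNorm hW' D₁, hsInner_le_mul_nuclearNorm hW' D₂]

/-! ### The square-root estimator -/

theorem rootLoss_sq {n : ℕ} (x : Fin n → Matrix (Fin m₁) (Fin m₂) ℝ) (y : Fin n → ℝ)
    (A : Matrix (Fin m₁) (Fin m₂) ℝ) :
    rootLoss x y A ^ 2 = (1 / (n : ℝ)) * ∑ i, (y i - scalarProd (x i) A) ^ 2 :=
  Real.sq_sqrt (mul_nonneg (by positivity) (Finset.sum_nonneg fun _ _ => sq_nonneg _))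

/-- If the noise is dominated by the penalty, the error `D` of the square-root estimator has
nuclear norm at most `3 u`, where `u` is the nuclear norm of a part of rank at most twice that of
the target, and its empirical second moment is controlled by `u`. -/
theorem sqrtEstimator_basic_inequality {n : ℕ} {x : Fin n → Matrix (Fin m₁) (Fin m₂) ℝ}
    {y w : Fin n → ℝ} {A₀ B : Matrix (Fin m₁) (Fin m₂) ℝ} {a lam : ℝ} (hlam : 0 < lam)
    (hA₀ : maxNorm A₀ ≤ a) (hw : ∀ i, y i - scalarProd (x i) A₀ = w i)
    (hnoise : 3 * specNorm (weightedMean w x) ≤ lam * rootLoss x y A₀)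
    (hB : IsSqrtEstimator a lam x y B) :
    ∃ u : ℝ, 0 ≤ u ∧ u ^ 2 ≤ 2 * A₀.rank * schattenNorm 2 (B - A₀) ^ 2 ∧
      schattenNorm 1 (B - A₀) ≤ 3 * u ∧
      (1 / (n : ℝ)) * ∑ i, scalarProd (x i) (B - A₀) ^ 2 ≤
        4 * lam * rootLoss x y A₀ * u + lam ^ 2 * u ^ 2 := by
  obtain ⟨u, v, hu, hv, hu2, hdec, htri⟩ := exists_schattenNorm_decomposition A₀ (B - A₀)
  rw [add_sub_cancel] at hdec
  set D := B - A₀ with hD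
  set Q := rootLoss x y A₀ with hQ
  have hQ0 : 0 ≤ Q := Real.sqrt_nonneg _
  have hQB0 : 0 ≤ rootLoss x y B := Real.sqrt_nonneg _
  have hres : ∀ i, y i - scalarProd (x i) B = w i - scalarProd (x i) D := fun i => by
    rw [hD, scalarProd_sub_right, ← hw]
    ring
  have hopt : rootLoss x y B ≤ Q + lam * (u - v) := by
    have h := hB.2 A₀ hA₀
    nlinarith
  have hscal : scalarProd (weightedMean w x) D ≤ lam * Q * (u + v) / 3 := by
    refine (scalarProd_le_specNorm_mul _ _).trans ?_
    have := mul_le_mul_of_nonneg_left htri (specNorm_nonneg (weightedMean w x))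
    nlinarith
  have hQsq : Q ^ 2 = (1 / (n : ℝ)) * ∑ i, w i ^ 2 := by
    rw [hQ, rootLoss_sq]; simp only [hw]
  have hQBsq : rootLoss x y B ^ 2 = (1 / (n : ℝ)) * ∑ i, (w i - scalarProd (x i) D) ^ 2 := by
    rw [rootLoss_sq]; simp only [hres]
  have hexpand : rootLoss x y B ^ 2 = Q ^ 2 - 2 * scalarProd (weightedMean w x) D +
      (1 / (n : ℝ)) * ∑ i, scalarProd (x i) D ^ 2 := by
    rw [hQBsq, hQsq, scalarProd_weightedMean]
    simp only [sub_sq, Finset.sum_add_distrib, Finset.sum_sub_distrib, mul_assoc,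
      ← Finset.mul_sum]
    ring
  -- convexity of the loss: its slope at `A₀` is that of the noise term
  have hconv : Q - lam * (u + v) / 3 ≤ rootLoss x y B := by
    rcases hQ0.eq_or_lt with h0 | h0
    · rw [← h0]
      have : 0 ≤ lam * (u + v) / 3 := by positivity
      linarith
    · have hCS : Q ^ 2 - scalarProd (weightedMean w x) D ≤ Q * rootLoss x y B := by
        refine le_trans (le_of_eq ?_) (abs_le_of_sq_le_sq' (a :=
          (1 / (n : ℝ)) * ∑ i, w i * (w i - scalarProd (x i) D)) ?_ (by positivity)).2
        · rw [hQsq, scalarProd_weightedMean]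
          simp only [mul_sub, Finset.sum_sub_distrib, sq]
        · rw [mul_pow, mul_pow, hQsq, hQBsq]
          have := Finset.sum_mul_sq_le_sq_mul_sq Finset.univ w
            fun i => w i - scalarProd (x i) D
          calc _ ≤ (1 / (n : ℝ)) ^ 2 *
                ((∑ i, w i ^ 2) * ∑ i, (w i - scalarProd (x i) D) ^ 2) :=
                mul_le_mul_of_nonneg_left this (sq_nonneg _)
            _ = _ := by ring
      have h1 : Q * (Q - lam * (u + v) / 3) ≤ Q * rootLoss x y B := by nlinarith
      exact le_of_mul_le_mul_left h1 h0
  have hv2 : v ≤ 2 * u := by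
    have : lam * v ≤ lam * (2 * u) := by nlinarith
    exact le_of_mul_le_mul_left this hlam
  refine ⟨u, hu, hu2, by linarith, ?_⟩
  have hsq : rootLoss x y B ^ 2 ≤ (Q + lam * u) ^ 2 :=
    pow_le_pow_left₀ hQB0 (hopt.trans (by nlinarith)) 2
  have h3 : lam * Q * (u + v) / 3 ≤ lam * Q * u := by
    have : 0 ≤ lam * Q := by positivity
    nlinarith
  nlinarith

end Matrices

/-! ### Reduction of the random design to finite sampling -/

section Sampling

variable {m₁ m₂ : ℕ}

instance instMeasurableSingletonClassMatrix :
    MeasurableSingletonClass (Matrix (Fin m₁) (Fin m₂) ℝ) :=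
  inferInstanceAs (MeasurableSingletonClass (Fin m₁ → Fin m₂ → ℝ))

theorem single_injective {p q : Fin m₁ × Fin m₂}
    (h : (Matrix.single p.1 p.2 1 : Matrix (Fin m₁) (Fin m₂) ℝ) = Matrix.single q.1 q.2 1) :
    p = q := by
  by_contra hne
  have h1 := congrFun (congrFun h p.1) p.2
  rw [Matrix.single_apply_same, Matrix.single_apply, if_neg] at h1
  · exact one_ne_zero h1
  · rintro ⟨h2, h3⟩
    exact hne (Prod.ext h2.symm h3.symm)

theorem sum_entryProb {law : Measure (Matrix (Fin m₁) (Fin m₂) ℝ)} [IsProbabilityMeasure law]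
    (hlaw : law (designSet m₁ m₂)ᶜ = 0) :
    ∑ q : Fin m₁ × Fin m₂, entryProb law q.1 q.2 = 1 := by
  have hU : designSet m₁ m₂ = ⋃ q ∈ (Finset.univ : Finset (Fin m₁ × Fin m₂)),
      {(Matrix.single q.1 q.2 1 : Matrix (Fin m₁) (Fin m₂) ℝ)} := by
    ext B
    simp [designSet, eq_comm]
  have hmeas : MeasurableSet (designSet m₁ m₂) := by
    rw [hU]
    exact Finset.measurableSet_biUnion _ fun q _ => measurableSet_singleton _
  have h1 : law.real (designSet m₁ m₂) = 1 := by
    rw [measureReal_def, (prob_compl_eq_zero_iff hmeas).1 hlaw, ENNReal.toReal_one]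
  rw [← h1, hU, measureReal_biUnion_finset]
  · rfl
  · intro p _ q _ hpq
    simp only [Function.onFun, Set.disjoint_singleton]
    exact fun h => hpq (single_injective h)
  · exact fun q _ => measurableSet_singleton _

variable {Ω : Type*} {n : ℕ}
  {X : Fin n → Ω → Matrix (Fin m₁) (Fin m₂) ℝ}
  {law : Measure (Matrix (Fin m₁) (Fin m₂) ℝ)}

/-- The event that the design equals a given tuple of matrices `e_j e_kᵀ`. -/
def designAtom (X : Fin n → Ω → Matrix (Fin m₁) (Fin m₂) ℝ) (x : Fin n → Fin m₁ × Fin m₂) :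
    Set Ω :=
  {ω | ∀ i, X i ω = Matrix.single (x i).1 (x i).2 1}

theorem designAtom_eq_of_mem {x y : Fin n → Fin m₁ × Fin m₂} {ω : Ω} (hx : ω ∈ designAtom X x)
    (hy : ω ∈ designAtom X y) : x = y :=
  funext fun i => single_injective ((hx i).symm.trans (hy i))

variable [MeasurableSpace Ω] {P : Measure Ω}

theorem measurableSet_designAtom (hX : ∀ i, Measurable (X i)) (x : Fin n → Fin m₁ × Fin m₂) :
    MeasurableSet (designAtom X x) := by
  have : designAtom X x = ⋂ i, X i ⁻¹' {Matrix.single (x i).1 (x i).2 1} := by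
    ext ω
    simp [designAtom]
  rw [this]
  exact MeasurableSet.iInter fun i => hX i (measurableSet_singleton _)

theorem measureReal_designAtom (hX : ∀ i, Measurable (X i)) (hind : iIndepFun X P)
    (hlaw : ∀ i, P.map (X i) = law) (x : Fin n → Fin m₁ × Fin m₂) :
    P.real (designAtom X x) = ∏ i, entryProb law (x i).1 (x i).2 := by
  have hset : designAtom X x =
      ⋂ i ∈ Finset.univ, X i ⁻¹' {Matrix.single (x i).1 (x i).2 1} := by
    ext ω
    simp [designAtom]
  rw [measureReal_def, hset, hind.measure_inter_preimage_eq_mul Finset.univ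
    fun i _ => measurableSet_singleton _, ENNReal.toReal_prod]
  refine Finset.prod_congr rfl fun i _ => ?_
  rw [entryProb, measureReal_def, ← hlaw i, Measure.map_apply (hX i) (measurableSet_singleton _)]

open Classical in
/-- The probability that the design has a given property is computed by finite sampling. -/
theorem measureReal_iUnion_designAtom [IsProbabilityMeasure P] (hX : ∀ i, Measurable (X i))
    (hind : iIndepFun X P) (hlaw : ∀ i, P.map (X i) = law) (G : (Fin n → Fin m₁ × Fin m₂) → Prop) :
    P.real (⋃ x ∈ Finset.univ.filter G, designAtom X x) =
      sampleMean (fun q => entryProb law q.1 q.2) n fun x => if G x then 1 else 0 := by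
  rw [measureReal_biUnion_finset, Finset.sum_filter]
  · refine Finset.sum_congr rfl fun x _ => ?_
    rw [measureReal_designAtom hX hind hlaw, mul_ite, mul_one, mul_zero]
  · intro x _ y _ hxy
    exact Set.disjoint_left.2 fun ω hx hy => hxy (designAtom_eq_of_mem hx hy)
  · exact fun x _ => measurableSet_designAtom hX x

/-- The integral of a function that is constant on finitely many disjoint events of total
probability one. -/
theorem integral_eq_sum_of_atoms {Z J : Type*} [MeasurableSpace Z] [Fintype J] {ρ : Measure Z}
    [IsProbabilityMeasure ρ] {A : J → Set Z} (hA : ∀ j, MeasurableSet (A j))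
    (hdisj : Pairwise (Function.onFun Disjoint A)) (hsum : ∑ j, ρ.real (A j) = 1) {f : Z → ℝ}
    {c : J → ℝ} (hf : ∀ j, ∀ z ∈ A j, f z = c j) : ∫ z, f z ∂ρ = ∑ j, ρ.real (A j) * c j := by
  classical
  have hU : ρ (⋃ j, A j)ᶜ = 0 := by
    rw [prob_compl_eq_zero_iff (MeasurableSet.iUnion hA), ← ENNReal.toReal_eq_one_iff,
      ← measureReal_def, ← hsum, ← Set.biUnion_univ, ← Finset.coe_univ]
    exact measureReal_biUnion_finset (fun i _ j _ hij => hdisj hij) fun j _ => hA j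
  have hae : f =ᵐ[ρ] fun z => ∑ j, (A j).indicator (fun _ => c j) z := by
    have : ∀ᵐ z ∂ρ, z ∈ ⋃ j, A j := hU
    filter_upwards [this] with z hz
    obtain ⟨j, hj⟩ := Set.mem_iUnion.1 hz
    rw [hf j z hj, Finset.sum_eq_single j, Set.indicator_of_mem hj]
    · intro i _ hij
      exact Set.indicator_of_notMem (fun hi => Set.disjoint_left.1 (hdisj hij) hi hj) _
    · simp
  rw [integral_congr_ae hae, integral_finsetSum]
  · exact Finset.sum_congr rfl fun j _ => by
      rw [integral_indicator_const _ (hA j), smul_eq_mul]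
  · exact fun j _ => (integrable_const _).indicator (hA j)

instance instIsProbabilityMeasureRademacher : IsProbabilityMeasure rademacher :=
  ⟨by simp [rademacher, ENNReal.inv_two_add_inv_two]⟩

theorem rademacher_singleton_boolSign (b : Bool) : rademacher.real {boolSign b} = 1 / 2 := by
  cases b <;> simp [rademacher, boolSign, measureReal_def, Set.indicator] <;> norm_num

theorem boolSign_injective : Function.Injective boolSign := by
  intro a b h
  cases a <;> cases b <;> simp [boolSign] at h ⊢ <;> norm_num at h

/-- `𝔼 ‖Σ_R‖` as a finite average over the sampled positions and signs. -/
theorem expNormSigmaR_eq_sampleMean [IsProbabilityMeasure P] [IsProbabilityMeasure law]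
    (hsupp : law (designSet m₁ m₂)ᶜ = 0) (hX : ∀ i, Measurable (X i)) (hind : iIndepFun X P)
    (hlaw : ∀ i, P.map (X i) = law) :
    expNormSigmaR P X =
      sampleMean (signedWeight fun q : Fin m₁ × Fin m₂ => entryProb law q.1 q.2) n fun z =>
      specNorm (weightedMean (fun i => boolSign (z i).2)
        fun i => (Matrix.single (z i).1.1 (z i).1.2 1 : Matrix (Fin m₁) (Fin m₂) ℝ)) := by
  set A : (Fin n → (Fin m₁ × Fin m₂) × Bool) → Set (Ω × (Fin n → ℝ)) := fun z =>
    designAtom X (fun i => (z i).1) ×ˢ {fun i => boolSign (z i).2} with hA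
  have hprob : ∀ z, (P.prod (Measure.pi fun _ : Fin n => rademacher)).real (A z) =
      ∏ i, signedWeight (fun q : Fin m₁ × Fin m₂ => entryProb law q.1 q.2) (z i) := fun z => by
    rw [hA, measureReal_prod_prod, measureReal_designAtom hX hind hlaw]
    simp only [signedWeight, div_eq_mul_one_div (entryProb _ _ _), Finset.prod_mul_distrib]
    congr 1
    rw [measureReal_def, Measure.pi_singleton, ENNReal.toReal_prod]
    exact Finset.prod_congr rfl fun i _ => rademacher_singleton_boolSign _
  refine (integral_eq_sum_of_atoms (A := A)
    (c := fun z => specNorm (weightedMean (fun i => boolSign (z i).2)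
      fun i => (Matrix.single (z i).1.1 (z i).1.2 1 : Matrix (Fin m₁) (Fin m₂) ℝ)))
    ?_ ?_ ?_ ?_).trans ?_
  · exact fun z => (measurableSet_designAtom hX _).prod (measurableSet_singleton _)
  · intro y z hyz
    refine Set.disjoint_left.2 fun ω hy hz => hyz (funext fun i => Prod.ext ?_ ?_)
    · exact congrFun (designAtom_eq_of_mem hy.1 hz.1) i
    · exact boolSign_injective (congrFun (hy.2.symm.trans hz.2) i)
  · simp only [hprob]
    have h := sampleMean_const (p := signedWeight fun q : Fin m₁ × Fin m₂ =>
      entryProb law q.1 q.2) ?_ n 1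
    · simpa [sampleMean] using h
    · rw [Fintype.sum_prod_type, ← sum_entryProb hsupp]
      refine Finset.sum_congr rfl fun q _ => ?_
      simp [signedWeight, mul_div_cancel₀]
  · rintro z ⟨ω, ε⟩ ⟨h1, h2⟩
    have h2' : ε = fun i => boolSign (z i).2 := h2
    simp only [h2']
    congr 2
    ext1 i
    exact h1 i
  · simp only [hprob, sampleMean]

end Sampling

/-! ### The error bound -/

section Estimation

variable {m₁ m₂ : ℕ}

theorem abs_apply_le_maxNorm (A : Matrix (Fin m₁) (Fin m₂) ℝ) (j : Fin m₁) (k : Fin m₂) :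
    |A j k| ≤ maxNorm A :=
  le_ciSup (f := fun q : Fin m₁ × Fin m₂ => |A q.1 q.2|) (Set.finite_range _).bddAbove (j, k)

/-- A lower bound on the sampling probabilities compares the Frobenius norm with the `L²` norm
under the sampling law. -/
theorem schattenNorm_two_sq_le {law : Measure (Matrix (Fin m₁) (Fin m₂) ℝ)} {κ : ℝ} (hκ : 0 < κ)
    (hπ : ∀ j k, κ⁻¹ ≤ entryProb law j k) (D : Matrix (Fin m₁) (Fin m₂) ℝ) :
    schattenNorm 2 D ^ 2 ≤
      κ * ∑ q : Fin m₁ × Fin m₂, entryProb law q.1 q.2 * D q.1 q.2 ^ 2 := by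
  rw [schattenNorm_two_sq, scalarProd_eq_sum, Fintype.sum_prod_type, Finset.mul_sum]
  refine Finset.sum_le_sum fun j _ => ?_
  rw [Finset.mul_sum]
  refine Finset.sum_le_sum fun k _ => ?_
  have h : 1 ≤ κ * entryProb law j k := by
    rw [← mul_inv_cancel₀ hκ.ne']
    exact mul_le_mul_of_nonneg_left (hπ j k) hκ.le
  nlinarith [mul_le_mul_of_nonneg_right h (sq_nonneg (D j k))]

/-- A matrix `D` of nuclear norm at most `3 u`, with `u² ≤ 2 r ‖D‖₂²`, satisfies the condition
under which restricted strong convexity holds. -/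
theorem signed_sum_le_of_schattenNorm_one_le {law : Measure (Matrix (Fin m₁) (Fin m₂) ℝ)}
    {κ : ℝ} (hκ : 0 < κ) (hπ : ∀ j k, κ⁻¹ ≤ entryProb law j k) {n : ℕ} (hn : 0 < n)
    {D : Matrix (Fin m₁) (Fin m₂) ℝ} {u r b : ℝ} (hr : 0 ≤ r) (hb : 0 < b)
    (hu2 : u ^ 2 ≤ 2 * r * schattenNorm 2 D ^ 2) (h1 : schattenNorm 1 D ≤ 3 * u)
    (z : Fin n → (Fin m₁ × Fin m₂) × Bool) :
    ∑ i, boolSign (z i).2 * (D (z i).1.1 (z i).1.2 / b) ≤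
      n * specNorm (weightedMean (fun i => boolSign (z i).2)
        fun i => (Matrix.single (z i).1.1 (z i).1.2 1 : Matrix (Fin m₁) (Fin m₂) ℝ)) *
      (√(18 * r * κ) * √(∑ q : Fin m₁ × Fin m₂,
        entryProb law q.1 q.2 * (D q.1 q.2 / b) ^ 2)) := by
  set V := ∑ q : Fin m₁ × Fin m₂, entryProb law q.1 q.2 * D q.1 q.2 ^ 2 with hV
  set S := weightedMean (fun i => boolSign (z i).2)
    fun i => (Matrix.single (z i).1.1 (z i).1.2 1 : Matrix (Fin m₁) (Fin m₂) ℝ) with hS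
  have hn' : (0 : ℝ) < n := by exact_mod_cast hn
  have hV2 := schattenNorm_two_sq_le hκ hπ D
  have hV0 : 0 ≤ V := by
    have : 0 ≤ κ * V := (sq_nonneg _).trans hV2
    exact nonneg_of_mul_nonneg_right this hκ
  have hscale : ∑ q : Fin m₁ × Fin m₂, entryProb law q.1 q.2 * (D q.1 q.2 / b) ^ 2 =
      V / b ^ 2 := by
    rw [hV, Finset.sum_div]
    exact Finset.sum_congr rfl fun q _ => by rw [div_pow, mul_div_assoc]
  have hleft : ∑ i, boolSign (z i).2 * (D (z i).1.1 (z i).1.2 / b) = n * scalarProd S D / b := by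
    rw [hS, scalarProd_weightedMean]
    simp only [scalarProd_single]
    rw [one_div, mul_inv_cancel_left₀ hn'.ne', Finset.sum_div]
    exact Finset.sum_congr rfl fun i _ => by rw [mul_div_assoc]
  have hu : 3 * u ≤ √(18 * r * κ) * √V := by
    rw [← Real.sqrt_mul (by positivity)]
    refine Real.le_sqrt_of_sq_le ?_
    nlinarith [mul_le_mul_of_nonneg_left hV2 hr]
  rw [hscale, hleft, Real.sqrt_div hV0, Real.sqrt_sq hb.le, ← mul_div_assoc, ← mul_div_assoc]
  refine div_le_div_of_nonneg_right ?_ hb.le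
  rw [mul_assoc]
  refine mul_le_mul_of_nonneg_left ?_ hn'.le
  exact (scalarProd_le_specNorm_mul S D).trans
    (mul_le_mul_of_nonneg_left (h1.trans hu) (specNorm_nonneg _))

/-- The threshold `θ` exceeds both the symmetrized empirical process on the level `θ` and the
deviation that McDiarmid's inequality allows with probability `1 / D`. -/
theorem threshold_le {n : ℕ} (hn : 0 < n) {D E M : ℝ} (hD : 1 ≤ D)
    {θ : ℝ} (hθ : 0 ≤ θ) (hθ2 : θ ^ 2 = 256 * M ^ 2 * E ^ 2 + 6 * √(Real.log D / n)) :
    4 * (n * E * (M * θ)) + √(2 * n * Real.log D) ≤ n * θ ^ 2 / 2 := by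
  have hn' : (0 : ℝ) < n := by exact_mod_cast hn
  have hlog : 0 ≤ Real.log D := Real.log_nonneg hD
  set l := √(Real.log D / n) with hl
  have hl0 : 0 ≤ l := Real.sqrt_nonneg _
  have h1 : 16 * M * E ≤ θ := by
    refine le_of_sq_le_sq ?_ hθ
    nlinarith
  have h2 : √(2 * n * Real.log D) ≤ n * (3 / 2 * l) := by
    refine Real.sqrt_le_iff.2 ⟨by positivity, ?_⟩
    have : l ^ 2 = Real.log D / n := Real.sq_sqrt (by positivity)
    rw [mul_pow, mul_pow, this]
    field_simp
    nlinarith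
  have h3 : 4 * (E * (M * θ)) ≤ θ ^ 2 / 4 := by nlinarith
  have h4 : 3 / 2 * l ≤ θ ^ 2 / 4 := by nlinarith [mul_nonneg (sq_nonneg M) (sq_nonneg E)]
  nlinarith [mul_le_mul_of_nonneg_left (add_le_add h3 h4) hn'.le]

/-- From the basic inequality and strong convexity to the error bound; `f`, `Q` and `κ` stand for
the squared Frobenius error, the loss at the target and the inverse of a lower bound on the sampling
probabilities. -/
theorem frobenius_bound_of_basic_inequality {f Q κ r u lam : ℝ} (hκ : 0 < κ) (hr : 0 < r)
    (hlam : lam ≤ √(1 / (16 * κ * r))) (hlam0 : 0 < lam) (hu2 : u ^ 2 ≤ 2 * r * f)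
    (h : f / (2 * κ) ≤ 4 * lam * Q * u + lam ^ 2 * u ^ 2) :
    f ≤ 256 * κ ^ 2 * r * (Q ^ 2 * lam ^ 2) := by
  have hl2 : lam ^ 2 * (16 * κ * r) ≤ 1 := by
    have := pow_le_pow_left₀ hlam0.le hlam 2
    rwa [Real.sq_sqrt (by positivity), le_div_iff₀ (by positivity)] at this
  have h1 : 16 * κ * r * (lam ^ 2 * u ^ 2) ≤ 2 * r * f := by nlinarith [sq_nonneg u]
  have h2 : 16 * κ * r * (4 * lam * Q * u) ≤ 2 * r * f + (32 * κ * r * lam * Q) ^ 2 := by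
    nlinarith [sq_nonneg (u - 32 * κ * r * lam * Q)]
  have h3 : 16 * κ * r * (f / (2 * κ)) = 8 * r * f := by
    field_simp
    ring
  have h4 : 8 * r * f ≤ 4 * r * f + 1024 * κ ^ 2 * r ^ 2 * lam ^ 2 * Q ^ 2 := by
    rw [← h3]
    nlinarith [mul_le_mul_of_nonneg_left h (by positivity : 0 ≤ 16 * κ * r)]
  have h5 : r * (4 * f) ≤ r * (4 * (256 * κ ^ 2 * r * (Q ^ 2 * lam ^ 2))) := by nlinarith
  have h6 := le_of_mul_le_mul_left h5 hr
  linarith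

end Estimation

theorem theorem8 :
    ∃ c : ℝ, 0 < c ∧
      ∀ {Ω : Type*} [MeasurableSpace Ω] (P : Measure Ω) [IsProbabilityMeasure P]
        (m₁ m₂ n : ℕ) (_ : 0 < m₁) (_ : 0 < m₂) (_ : 0 < n)
        -- the unknown matrix, the noise level, the design, the noise, the observations
        (A₀ : Matrix (Fin m₁) (Fin m₂) ℝ) (σ : ℝ) (_ : 0 ≤ σ)
        (X : Fin n → Ω → Matrix (Fin m₁) (Fin m₂) ℝ)
        (ξ Y : Fin n → Ω → ℝ)
        (_ : ∀ i ω, Y i ω = ((X i ω).transpose * A₀).trace + σ * ξ i ω)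
        -- the noise variables are independent, centered, of variance one
        (_ : ∀ i, Measurable (ξ i)) (_ : iIndepFun ξ P)
        (_ : ∀ i, ∫ ω, ξ i ω ∂P = 0) (_ : ∀ i, ∫ ω, ξ i ω ^ 2 ∂P = 1)
        -- the design matrices are i.i.d. with law `law`, carried by the matrices `e_j e_kᵀ`
        (law : Measure (Matrix (Fin m₁) (Fin m₂) ℝ)) [IsProbabilityMeasure law]
        (_ : law (designSet m₁ m₂)ᶜ = 0)
        (_ : ∀ i, Measurable (X i)) (_ : iIndepFun X P) (_ : ∀ i, P.map (X i) = law)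
        -- the two assumptions on the sampling distribution
        (L : ℝ) (_ : 1 ≤ L)
        (_ : (∀ k, colProb law k ≤ L / (min m₁ m₂ : ℕ)) ∧
          ∀ j, rowProb law j ≤ L / (min m₁ m₂ : ℕ))
        (μ : ℝ) (_ : 1 ≤ μ)
        (_ : ∀ j k, (μ * m₁ * m₂)⁻¹ ≤ entryProb law j k)
        -- the bound on the entries and the regularization parameter
        (a : ℝ) (_ : maxNorm A₀ ≤ a)
        (lam : ℝ) (_ : 0 < lam)
        -- `lam ≤ √ρ`, where `ρ = +∞` if `A₀ = 0`
        (_ : A₀ ≠ 0 → lam ≤ √(1 / (16 * μ * m₁ * m₂ * A₀.rank))),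
        ∃ E : Set Ω, MeasurableSet E ∧ 1 - 2 / ((m₁ + m₂ : ℕ) : ℝ) ≤ P.real E ∧
          ∀ ω ∈ E,
            -- `lam ≥ 3 ‖Σ‖ / Q(A₀)`, where `Σ = 0` if `Q(A₀) = 0`
            3 * specNorm (weightedMean (fun i => σ * ξ i ω) (fun i => X i ω)) ≤
                lam * rootLoss (fun i => X i ω) (fun i => Y i ω) A₀ →
            ∀ B : Matrix (Fin m₁) (Fin m₂) ℝ,
              IsSqrtEstimator a lam (fun i => X i ω) (fun i => Y i ω) B →
              schattenNorm 2 (B - A₀) ^ 2 / (m₁ * m₂) ≤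
                c * max
                  (μ ^ 2 * m₁ * m₂ * A₀.rank *
                    (rootLoss (fun i => X i ω) (fun i => Y i ω) A₀ ^ 2 * lam ^ 2 +
                      a ^ 2 * expNormSigmaR P X ^ 2))
                  (a ^ 2 * μ * √(Real.log ((m₁ + m₂ : ℕ) : ℝ) / n)) := by
  classical
  refine ⟨20000, by norm_num, ?_⟩
  intro Ω _ P _ m₁ m₂ n hm₁ hm₂ hn A₀ σ _ X ξ Y hY _ _ _ _ law _ hsupp hX hind hlaw L _ _ μ hμ hπ
    a hA₀ lam hlam hlamρ
  have hn' : (0 : ℝ) < n := by exact_mod_cast hn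
  have hm₁' : (0 : ℝ) < m₁ := by exact_mod_cast hm₁
  have hm₂' : (0 : ℝ) < m₂ := by exact_mod_cast hm₂
  have hμ0 : 0 < μ := by linarith
  have ha0 : 0 ≤ a := (abs_nonneg _).trans ((abs_apply_le_maxNorm A₀ ⟨0, hm₁⟩ ⟨0, hm₂⟩).trans hA₀)
  set d : ℝ := ((m₁ + m₂ : ℕ) : ℝ) with hd
  have hd2 : 2 ≤ d := by
    rw [hd]
    exact_mod_cast (by omega : 2 ≤ m₁ + m₂)
  set κ : ℝ := μ * m₁ * m₂ with hκdef
  have hκ : 0 < κ := by positivity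
  set r : ℝ := (A₀.rank : ℝ) with hrdef
  have hr0 : 0 ≤ r := Nat.cast_nonneg _
  set ES := expNormSigmaR P X with hES
  have hES0 : 0 ≤ ES := integral_nonneg fun _ => specNorm_nonneg _
  set l := √(Real.log d / n) with hl
  have hl0 : 0 < l := Real.sqrt_pos.2 (div_pos (Real.log_pos (by linarith)) hn')
  set M := √(18 * r * κ) with hM
  have hM2 : M ^ 2 = 18 * r * κ := Real.sq_sqrt (by positivity)
  set θ := √(256 * M ^ 2 * ES ^ 2 + 6 * l) with hθdef
  have hθ2 : θ ^ 2 = 256 * M ^ 2 * ES ^ 2 + 6 * l := Real.sq_sqrt (by positivity)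
  have hθ : 0 < θ := Real.sqrt_pos.2 (by positivity)
  set p : Fin m₁ × Fin m₂ → ℝ := fun q => entryProb law q.1 q.2 with hp
  have hp0 : ∀ q, 0 ≤ p q := fun q => measureReal_nonneg
  set N : (Fin n → (Fin m₁ × Fin m₂) × Bool) → ℝ := fun z =>
    n * specNorm (weightedMean (fun i => boolSign (z i).2)
      fun i => (Matrix.single (z i).1.1 (z i).1.2 1 : Matrix (Fin m₁) (Fin m₂) ℝ)) with hN
  have hNmean : sampleMean (signedWeight p) n N = n * ES := by
    rw [hES, expNormSigmaR_eq_sampleMean hsupp hX hind hlaw, mul_comm, ← sampleMean_mul_const]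
    simp only [hN, mul_comm, hp]
  have hrsc := restricted_strong_convexity hp0 (sum_entryProb hsupp) hn (by linarith : 1 ≤ d) N
    (M := M) hθ (by
      rw [hNmean]
      exact threshold_le hn (by linarith) hθ.le hθ2)
  rw [← measureReal_iUnion_designAtom hX hind hlaw] at hrsc
  refine ⟨_, Finset.measurableSet_biUnion _ fun x _ => measurableSet_designAtom hX x,
    le_trans ?_ hrsc, ?_⟩
  · have : 1 / d ≤ 2 / d := by gcongr; norm_num
    linarith
  intro ω hω hnoise B hB
  obtain ⟨x, hxG, hxω⟩ := Set.mem_iUnion₂.1 hω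
  have hx := (Finset.mem_filter.1 hxG).2
  obtain ⟨u, hu, hu2, h1, hbasic⟩ := sqrtEstimator_basic_inequality hlam hA₀
    (fun i => by rw [hY, scalarProd]; ring) hnoise hB
  set D := B - A₀ with hD
  set Q := rootLoss (fun i => X i ω) (fun i => Y i ω) A₀ with hQ
  set f := schattenNorm 2 D ^ 2 with hf
  rw [← hrdef] at hu2
  have hmm : (0 : ℝ) < m₁ * m₂ := by positivity
  have hmax0 : 0 ≤ max (μ ^ 2 * m₁ * m₂ * r * (Q ^ 2 * lam ^ 2 + a ^ 2 * ES ^ 2))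
      (a ^ 2 * μ * l) := le_max_of_le_right (by positivity)
  -- a vanishing target is recovered exactly
  rcases eq_or_ne A₀ 0 with hA | hA
  · have hr : r = 0 := by rw [hrdef, hA, Matrix.rank_zero, Nat.cast_zero]
    have hu0 : u = 0 := by
      rw [hr] at hu2
      exact pow_eq_zero_iff two_ne_zero |>.1 (le_antisymm (by simpa using hu2) (sq_nonneg _))
    have hf0 : f ≤ 0 := by
      rw [hf, schattenNorm_two_sq]
      refine (scalarProd_le_specNorm_mul D D).trans ?_
      refine mul_nonpos_of_nonneg_of_nonpos (specNorm_nonneg _) ?_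
      linarith
    exact (div_nonpos_of_nonpos_of_nonneg hf0 hmm.le).trans (by positivity)
  have hrpos : 0 < r := by
    rw [hrdef, Nat.cast_pos, Nat.pos_iff_ne_zero]
    intro h0
    have h2 := finrank_range_toEuclideanLin A₀
    rw [h0, Submodule.finrank_eq_zero, LinearMap.range_eq_bot] at h2
    exact hA (by simpa using h2)
  have hapos : 0 < a := by
    refine ha0.lt_of_ne fun h0 => hA ?_
    ext j k
    have := (abs_apply_le_maxNorm A₀ j k).trans hA₀
    rw [← h0] at this
    simpa using this
  set V := ∑ q : Fin m₁ × Fin m₂, p q * D q.1 q.2 ^ 2 with hV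
  have hfV : f ≤ κ * V := schattenNorm_two_sq_le hκ hπ D
  have hscale : ∑ q, p q * (D q.1 q.2 / (2 * a)) ^ 2 = V / (2 * a) ^ 2 := by
    rw [hV, Finset.sum_div]
    exact Finset.sum_congr rfl fun q _ => by rw [div_pow, mul_div_assoc]
  rcases lt_or_ge (V / (2 * a) ^ 2) (θ ^ 2) with hlt | hge
  -- below the threshold of strong convexity, the threshold itself is the bound
  · rw [div_lt_iff₀ (by positivity), hθ2, hM2] at hlt
    have h3 : f / (m₁ * m₂) ≤ μ * V := by
      rw [div_le_iff₀ hmm]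
      refine hfV.trans (le_of_eq ?_)
      rw [hκdef]; ring
    have h4 : μ * V ≤ 18432 * (μ ^ 2 * m₁ * m₂ * r * (a ^ 2 * ES ^ 2)) +
        24 * (a ^ 2 * μ * l) := by
      refine (mul_le_mul_of_nonneg_left hlt.le hμ0.le).trans (le_of_eq ?_)
      rw [hκdef]; ring
    have h5 : μ ^ 2 * m₁ * m₂ * r * (a ^ 2 * ES ^ 2) ≤
        μ ^ 2 * m₁ * m₂ * r * (Q ^ 2 * lam ^ 2 + a ^ 2 * ES ^ 2) :=
      mul_le_mul_of_nonneg_left (le_add_of_nonneg_left (by positivity)) (by positivity)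
    have h6 := h5.trans (le_max_left _ (a ^ 2 * μ * l))
    have h7 := le_max_right (μ ^ 2 * m₁ * m₂ * r * (Q ^ 2 * lam ^ 2 + a ^ 2 * ES ^ 2))
      (a ^ 2 * μ * l)
    linarith
  -- above it, strong convexity applies to `D / (2 a)`, whose entries are at most `1`
  · have h3 := hx (fun q => D q.1 q.2 / (2 * a)) (fun q => ?_) (fun z => ?_) (by rwa [hscale])
    · have hsum : ∑ i, (D (x i).1 (x i).2 / (2 * a)) ^ 2 =
          (∑ i, scalarProd (X i ω) D ^ 2) / (2 * a) ^ 2 := by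
        rw [Finset.sum_div]
        refine Finset.sum_congr rfl fun i _ => ?_
        rw [hxω i, scalarProd_single, div_pow]
      rw [hscale, hsum] at h3
      have h4 : V / 2 ≤ (1 / (n : ℝ)) * ∑ i, scalarProd (X i ω) D ^ 2 := by
        rw [one_div, inv_mul_eq_div, le_div_iff₀ hn']
        have h5 := mul_le_mul_of_nonneg_right h3 (by positivity : 0 ≤ (2 * a) ^ 2)
        rw [div_mul_cancel₀ _ (by positivity)] at h5
        refine le_trans (le_of_eq ?_) h5
        field_simp
      have h5 : f / (2 * κ) ≤ V / 2 := by
        rw [div_le_iff₀ (by positivity)]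
        linarith
      have h6 := frobenius_bound_of_basic_inequality hκ hrpos
        (by simpa only [hκdef, mul_assoc] using hlamρ hA) hlam hu2 ((h5.trans h4).trans hbasic)
      have h7 : f / (m₁ * m₂) ≤ 256 * (μ ^ 2 * m₁ * m₂ * r * (Q ^ 2 * lam ^ 2)) := by
        rw [div_le_iff₀ hmm]
        refine h6.trans (le_of_eq ?_)
        rw [hκdef]; ring
      have h8 : μ ^ 2 * m₁ * m₂ * r * (Q ^ 2 * lam ^ 2) ≤
          μ ^ 2 * m₁ * m₂ * r * (Q ^ 2 * lam ^ 2 + a ^ 2 * ES ^ 2) :=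
        mul_le_mul_of_nonneg_left (le_add_of_nonneg_right (by positivity)) (by positivity)
      have h9 := h8.trans (le_max_left _ (a ^ 2 * μ * l))
      linarith
    · rw [abs_div, abs_of_pos (by positivity : 0 < 2 * a), div_le_one (by positivity), hD,
        Matrix.sub_apply]
      have e1 := (abs_apply_le_maxNorm B q.1 q.2).trans hB.1
      have e2 := (abs_apply_le_maxNorm A₀ q.1 q.2).trans hA₀
      linarith [abs_sub (B q.1 q.2) (A₀ q.1 q.2)]
    · exact signed_sum_le_of_schattenNorm_one_le hκ hπ hn hr0 (by positivity) hu2 h1 z
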